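/- Let $2\omega_1,2\omega_3\in\mathbb C$ be linearly independent over $\mathbb R$, $\Gamma=2\omega_1\mathbb Z\oplus2\omega_3\mathbb Z$, $\omega_0=0$, $\omega_2=-\omega_1-\omega_3$, let $\wp,\zeta,\sigma$ be the Weierstrass functions of $\Gamma$, $e_i=\wp(\omega_i)$, $\eta_i=\zeta(\omega_i)$ and $\sigma_i(x)=e^{-\eta_ix}\sigma(x+\omega_i)/\sigma(\omega_i)$ $(i=1,2,3)$. Let $l_0,\dots,l_3\in\mathbb Z_{\ge0}$, $M\ge0$, $r_1,\dots,r_M\in\mathbb Z_{>0}$, $s_1,\dots,s_M,E\in\mathbb C$, and let $\delta_1,\dots,\delta_M\in\mathbb C$ with $2\delta_{i'}\notin\Gamma$ and with $b_{i'}=\wp(\delta_{i'})$ pairwise distinct. Put $$v(x)=\sum_{i=0}^3l_i(l_i+1)\wp(x+\omega_i)+\sum_{i'=1}^M\Big[\tfrac{r_{i'}}2\big(\tfrac{r_{i'}}2+1\big)\big(\wp(x-\delta_{i'})+\wp(x+\delta_{i'})\big)+\frac{s_{i'}}{\wp(x)-b_{i'}}\Big],$$ $$\Psi_g(x)=\prod_{i'=1}^M(\wp(x)-b_{i'})^{r_{i'}/2},\qquad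 l=\sum_{i=0}^3l_i+\sum_{i'=1}^Mr_{i'},\qquad \tilde l_0=l_0+\sum_{i'=1}^Mr_{i'},\quad \tilde l_i=l_i\ (i=1,2,3).$$ The equation $-f''+vf=Ef$ is transformed by $z=\wp(x)$, $f(x)=\tilde f(z)\prod_{i=1}^3(z-e_i)^{-l_i/2}\prod_{i'=1}^M(z-b_{i'})^{-r_{i'}/2}$ into the Fuchsian equation $$\tilde f''+\Big(\sum_{i=1}^3\frac{\frac12-l_i}{z-e_i}-\sum_{i'=1}^M\frac{r_{i'}}{z-b_{i'}}\Big)\tilde f'+\frac{l(l-2l_0-1)z+p+\sum_{i'}\frac{o_{i'}}{z-b_{i'}}}{4(z-e_1)(z-e_2)(z-e_3)}\tilde f=0$$ with constants $p,o_{i'}$ determined by the other parameters. Assume that all its singular points $z=b_{i'}$ are apparent (integer exponents and no logarithmic solutions). Assume that the space of even doubly-periodic (periods $2\omega_1,2\omega_3$) meromorphic solutions of $$\Xi'''-4(v-E)\Xi'-2v'\,\Xi=0$$ is one-dimensional, let $\Xi$ be a nonzero element of it, and assume that the constant $Q=\Xi^2(E-v)+\tfrac12\Xi\,\Xi''-\tfrac14(\Xi')^2$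 is nonzero. Fix a square root $\sqrt{-Q}$ and let $$\Lambda(x)=\sqrt{\Xi(x)}\,\exp\int\frac{\sqrt{-Q}\,dx}{\Xi(x)}$$ (a multivalued function, defined up to a nonzero constant factor). (i) There are $t_1,\dots,t_l,c\in\mathbb C$ such that every branch of $\Lambda$ on a domain free of singular points and of zeros of $\Xi$, with any branch of $\Psi_g$ there, has for some constant $C_0\ne0$ the form $$\Lambda(x)=\frac{C_0\prod_{j=1}^l\sigma(x-t_j)}{\Psi_g(x)\,\sigma(x)^{\tilde l_0}\sigma_1(x)^{\tilde l_1}\sigma_2(x)^{\tilde l_2}\sigma_3(x)^{\tilde l_3}}\,e^{cx}.$$ Moreover, for every such expression of a branch of $\Lambda$ on such a domain, with congruences modulo $\Gamma$: (ii) $t_j+t_{j'}\not\equiv0$ for all $j,j'$ (including $j=j'$). (iii) If $t_j\not\equiv\pm\delta_{i'}$ for all $i'$, then $t_j\not\equiv t_{j'}$ for all $j'\ne j$. (iv) If $t_j\equiv\delta_{i'}$ or $t_j\equiv-\delta_{i'}$, then $\#\{j'\mid t_{j'}\equiv t_j\}=r_{i'}+1$. (v) If $l_0\ne0$, then $c=\sum_{j=1}^l\zeta(t_j)$.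 If $l_0=0$, then $\Xi$ has a finite nonzero value (limit) $\Xi(0)$ at $x=0$ and $c=\sum_{j=1}^l\zeta(t_j)+\sqrt{-Q}/\Xi(0)$. (vi) $\Xi$ is a function of $z=\wp(x)$, and for every $j$, with $z_j=\wp(t_j)$: if $t_j\not\equiv\pm\delta_{i'}$ for all $i'$, then $$\left.\frac{d\Xi}{dz}\right|_{z=z_j}=\frac{2\sqrt{-Q}}{\wp'(t_j)};$$ if $t_j\equiv\delta_{i'}$ or $t_j\equiv-\delta_{i'}$, then $$\left.\frac{d\Xi}{dz}\right|_{z=z_j}=\frac{2\sqrt{-Q}}{(r_{i'}+1)\,\wp'(t_j)}.$$ -/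

import Mathlib

open Filter Topology

namespace PeriodPair

/-- The half-periods `ω₀ = 0`, `ω₁`, `ω₂ = -ω₁ - ω₃`, `ω₃`, where the basic periods
`(2ω₁, 2ω₃)` are the two periods `(L.ω₁, L.ω₂)` of the period pair `L`. -/
noncomputable def halfPeriod (L : PeriodPair) : Fin 4 → ℂ :=
  ![0, L.ω₁ / 2, -(L.ω₁ / 2) - L.ω₂ / 2, L.ω₂ / 2]

/-- The Weierstrass sigma function. The product may be taken over all periods, as the factor
belonging to the period `0` is `(1 - z / 0) * exp (z / 0 + z ^ 2 / (2 * 0 ^ 2)) = 1`. -/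
noncomputable def weierstrassSigma (L : PeriodPair) (z : ℂ) : ℂ :=
  z * ∏' w : L.lattice,
    (1 - z / (w : ℂ)) * Complex.exp (z / (w : ℂ) + z ^ 2 / (2 * (w : ℂ) ^ 2))

/-- The Weierstrass zeta function `ζ = σ' / σ`. -/
noncomputable def weierstrassZeta (L : PeriodPair) (z : ℂ) : ℂ :=
  deriv L.weierstrassSigma z / L.weierstrassSigma z

/-- The co-sigma functions `σᵢ(z) = exp(-ηᵢ z) σ(z + ωᵢ) / σ(ωᵢ)`, `ηᵢ = ζ(ωᵢ)`
(used for `i = 1, 2, 3`). -/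
noncomputable def coSigma (L : PeriodPair) (i : Fin 4) (z : ℂ) : ℂ :=
  Complex.exp (-(L.weierstrassZeta (L.halfPeriod i)) * z) *
    L.weierstrassSigma (z + L.halfPeriod i) / L.weierstrassSigma (L.halfPeriod i)

end PeriodPair

/-- For the linear equation `f'' + p f' + q f = 0` with an isolated singularity at `a`:
the exponents at `a` are integers and there are no logarithmic solutions, i.e. near `a` there is
a fundamental system of solutions that are meromorphic at `a`. -/
def IsApparentSingularity (p q : ℂ → ℂ) (a : ℂ) : Prop :=
  ∃ f g : ℂ → ℂ, MeromorphicAt f a ∧ MeromorphicAt g a ∧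
    (∀ᶠ z in 𝓝[≠] a, deriv (deriv f) z + p z * deriv f z + q z * f z = 0) ∧
    (∀ᶠ z in 𝓝[≠] a, deriv (deriv g) z + p z * deriv g z + q z * g z = 0) ∧
    (∀ᶠ z in 𝓝[≠] a, f z * deriv g z - deriv f z * g z ≠ 0)

/-- The parameters of the equation `(-d²/dx² + v(x) - E) f = 0`. -/
structure EllipticData where
  /-- the basic periods `(2ω₁, 2ω₃)` -/
  L : PeriodPair
  /-- the nonnegative integers `l₀, l₁, l₂, l₃` -/
  l : Fin 4 → ℕ
  /-- the number of additional singularities -/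
  M : ℕ
  /-- the integers `r` at the additional singularities -/
  r : Fin M → ℕ
  /-- the points `δ`; the additional singularities are `z = ℘(δ)`, i.e. `x = ±δ` -/
  δ : Fin M → ℂ
  /-- the coefficients `s` -/
  s : Fin M → ℂ
  /-- the eigenvalue -/
  E : ℂ

namespace EllipticData

variable (D : EllipticData)

/-- `b = ℘(δ)`. -/
noncomputable def b (i : Fin D.M) : ℂ := D.L.weierstrassP (D.δ i)

/-- `eᵢ = ℘(ωᵢ)`, used for `i = 1, 2, 3`. -/
noncomputable def e (i : Fin 4) : ℂ := D.L.weierstrassP (D.L.halfPeriod i)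

/-- `l₀ + l₁ + l₂ + l₃ + ∑ r`. -/
def N : ℕ := ∑ i, D.l i + ∑ i, D.r i

/-- `l̃₀ = l₀ + ∑ r` and `l̃ᵢ = lᵢ` for `i = 1, 2, 3`. -/
def lTilde : Fin 4 → ℕ := ![D.l 0 + ∑ i, D.r i, D.l 1, D.l 2, D.l 3]

/-- The potential `v`. -/
noncomputable def v (x : ℂ) : ℂ :=
  ∑ i : Fin 4, (D.l i : ℂ) * ((D.l i : ℂ) + 1) * D.L.weierstrassP (x + D.L.halfPeriod i) +
  ∑ i : Fin D.M,
    ((D.r i : ℂ) / 2 * ((D.r i : ℂ) / 2 + 1) *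
        (D.L.weierstrassP (x - D.δ i) + D.L.weierstrassP (x + D.δ i)) +
      D.s i / (D.L.weierstrassP x - D.b i))

/-- The residue parameters `o` of the algebraic form of the equation. -/
noncomputable def o (i : Fin D.M) : ℂ :=
  -D.s i + (D.r i : ℂ) *
    (1 / 8 * (D.r i : ℂ) * (12 * D.b i ^ 2 - D.L.g₂) +
      1 / 2 * (4 * D.b i ^ 3 - D.L.g₂ * D.b i - D.L.g₃) *
        (∑ k ∈ Finset.univ.erase i, (D.r k : ℂ) / (D.b i - D.b k)) +
      2 * ((D.l 1 : ℂ) * (D.b i - D.e 2) * (D.b i - D.e 3) +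
        (D.l 2 : ℂ) * (D.b i - D.e 1) * (D.b i - D.e 3) +
        (D.l 3 : ℂ) * (D.b i - D.e 1) * (D.b i - D.e 2)))

/-- The accessory parameter `p` of the algebraic form of the equation. -/
noncomputable def p : ℂ :=
  D.E + (D.e 1 * (D.l 1 : ℂ) ^ 2 + D.e 2 * (D.l 2 : ℂ) ^ 2 + D.e 3 * (D.l 3 : ℂ) ^ 2)
    - 2 * ((D.l 1 : ℂ) * (D.l 2 : ℂ) * D.e 3 + (D.l 2 : ℂ) * (D.l 3 : ℂ) * D.e 1 +
        (D.l 3 : ℂ) * (D.l 1 : ℂ) * D.e 2)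
    - 1 / 2 * ∑ i, D.b i * (D.r i : ℂ) ^ 2
    + 2 * ∑ i, ((D.l 1 : ℂ) * (D.r i : ℂ) * (D.e 1 + D.b i) +
        (D.l 2 : ℂ) * (D.r i : ℂ) * (D.e 2 + D.b i) +
        (D.l 3 : ℂ) * (D.r i : ℂ) * (D.e 3 + D.b i))
    + 2 * (∑ i, D.b i * (D.r i : ℂ)) * ∑ i, (D.r i : ℂ)

/-- Coefficient of `d/dz` in the Fuchsian equation in the variable `z = ℘(x)`. -/
noncomputable def fuchsP (z : ℂ) : ℂ :=
  (1 / 2 - (D.l 1 : ℂ)) / (z - D.e 1) + (1 / 2 - (D.l 2 : ℂ)) / (z - D.e 2) +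
    (1 / 2 - (D.l 3 : ℂ)) / (z - D.e 3) + ∑ i, -(D.r i : ℂ) / (z - D.b i)

/-- Coefficient of order zero in the Fuchsian equation in the variable `z = ℘(x)`. -/
noncomputable def fuchsQ (z : ℂ) : ℂ :=
  ((D.N : ℂ) * ((D.N : ℂ) - 2 * (D.l 0 : ℂ) - 1) * z + D.p + ∑ i, D.o i / (z - D.b i)) /
    (4 * (z - D.e 1) * (z - D.e 2) * (z - D.e 3))

/-- The points `ωᵢ` and `±δ` modulo periods; these contain all singularities of the equation. -/
def sing : Set ℂ :=
  {x | 2 * x ∈ D.L.lattice ∨ ∃ i, x - D.δ i ∈ D.L.lattice ∨ x + D.δ i ∈ D.L.lattice}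

/-- The space of even doubly-periodic (meromorphic) solutions of
`Ξ''' - 4 (v - E) Ξ' - 2 v' Ξ = 0`. Solutions are holomorphic functions on the complement
of `D.sing`; the irrelevant values on the discrete set `D.sing` are put equal to `0`, so that
every solution is represented by exactly one element. -/
noncomputable def evenPeriodicSolutions : Submodule ℂ (ℂ → ℂ) where
  carrier := {f | (∀ x, MeromorphicAt f x) ∧ (∀ x, f (-x) = f x) ∧
    (∀ x, f (x + D.L.ω₁) = f x) ∧ (∀ x, f (x + D.L.ω₂) = f x) ∧
    (∀ x ∈ D.sing, f x = 0) ∧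
    ∀ x ∉ D.sing, AnalyticAt ℂ f x ∧
      iteratedDeriv 3 f x - 4 * (D.v x - D.E) * deriv f x - 2 * deriv D.v x * f x = 0}
  add_mem' := by
    rintro f g ⟨hf1, hf2, hf3, hf4, hf5, hf6⟩ ⟨hg1, hg2, hg3, hg4, hg5, hg6⟩
    refine ⟨fun x => (hf1 x).add (hg1 x), fun x => by simp [hf2, hg2],
      fun x => by simp [hf3, hg3], fun x => by simp [hf4, hg4],
      fun x hx => by simp [hf5 x hx, hg5 x hx], fun x hx => ?_⟩
    obtain ⟨haf, hf⟩ := hf6 x hx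
    obtain ⟨hag, hg⟩ := hg6 x hx
    refine ⟨haf.add hag, ?_⟩
    rw [iteratedDeriv_add haf.contDiffAt hag.contDiffAt,
      deriv_add haf.differentiableAt hag.differentiableAt]
    simp only [Pi.add_apply]
    linear_combination hf + hg
  zero_mem' := by
    refine ⟨fun x => MeromorphicAt.const 0 x, by simp, by simp, by simp, by simp,
      fun x _ => ⟨analyticAt_const, ?_⟩⟩
    have h : deriv (0 : ℂ → ℂ) = 0 := by
      funext y
      exact deriv_const y (0 : ℂ)
    simp [h]
  smul_mem' := by
    rintro c f ⟨hf1, hf2, hf3, hf4, hf5, hf6⟩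
    refine ⟨fun x => (MeromorphicAt.const c x).smul (hf1 x), fun x => by simp [hf2],
      fun x => by simp [hf3], fun x => by simp [hf4],
      fun x hx => by simp [hf5 x hx], fun x hx => ?_⟩
    obtain ⟨haf, hf⟩ := hf6 x hx
    refine ⟨analyticAt_const.smul haf, ?_⟩
    rw [iteratedDeriv_const_smul haf.contDiffAt, deriv_const_smul c haf.differentiableAt]
    simp only [Pi.smul_apply, smul_eq_mul]
    linear_combination c * hf

/-- The expression `Ξ² (E - v) + Ξ Ξ'' / 2 - (Ξ')² / 4` at the point `x`. -/
noncomputable def Q (Ξ : ℂ → ℂ) (x : ℂ) : ℂ :=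
  Ξ x ^ 2 * (D.E - D.v x) + 1 / 2 * Ξ x * deriv (deriv Ξ) x - 1 / 4 * deriv Ξ x ^ 2

/-- `U` is a domain, free of singularities of the equation and of zeros of `Ξ`. -/
def IsRegularDomain (Ξ : ℂ → ℂ) (U : Set ℂ) : Prop :=
  IsOpen U ∧ IsConnected U ∧ ∀ x ∈ U, x ∉ D.sing ∧ Ξ x ≠ 0

/-- `Λ` is a single-valued branch on `U` of the multivalued function
`√Ξ(x) exp ∫ κ dx / Ξ(x)`: near each point of `U` it is `R exp I` with `R² = Ξ`, `I' = κ / Ξ`. -/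
def IsLambdaBranch (Ξ : ℂ → ℂ) (κ : ℂ) (U : Set ℂ) (Λ : ℂ → ℂ) : Prop :=
  ∀ x ∈ U, ∃ R I : ℂ → ℂ, AnalyticAt ℂ R x ∧
    ∀ᶠ y in 𝓝 x, R y ^ 2 = Ξ y ∧ HasDerivAt I (κ / Ξ y) y ∧ Λ y = R y * Complex.exp (I y)

/-- `Ψ` is a single-valued branch on `U` of `∏ (℘(x) - ℘(δ)) ^ (r / 2)`. -/
def IsPsiBranch (U : Set ℂ) (Ψ : ℂ → ℂ) : Prop :=
  AnalyticOnNhd ℂ Ψ U ∧ ∀ x ∈ U, Ψ x ^ 2 = ∏ i, (D.L.weierstrassP x - D.b i) ^ D.r i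

/-- The Bethe-Ansatz expression of `Λ` on `U` with zeros `t`, exponent `c` and constant `C₀`. -/
def IsBetheForm (U : Set ℂ) (Λ Ψ : ℂ → ℂ) (t : Fin D.N → ℂ) (c C₀ : ℂ) : Prop :=
  C₀ ≠ 0 ∧ ∀ x ∈ U, Λ x =
    C₀ * (∏ j, D.L.weierstrassSigma (x - t j)) /
      (Ψ x * D.L.weierstrassSigma x ^ D.lTilde 0 * D.L.coSigma 1 x ^ D.lTilde 1 *
        D.L.coSigma 2 x ^ D.lTilde 2 * D.L.coSigma 3 x ^ D.lTilde 3) * Complex.exp (c * x)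

end EllipticData

/-!
The function `Λ` is a square root of `Ξ` times an exponential integral, so that its logarithmic
derivative `L = (Ξ' + 2κ) / (2Ξ)` is a single-valued elliptic function. The identity
`κ² = -Q` says exactly that `L` solves the Riccati equation `L' + L² = v - E`, i.e. that `Λ` solves
`f'' = (v - E) f`. The proof studies `L` in place of `Λ`.

*Local analysis.* At a point `a` the potential has leading term `(m/2)(m/2 + 1) / (x - a)²`, where
`m = D.weight a` is `2 lᵢ` at a half-period, `r` at `±δ` and `0` elsewhere. Hence `L` has at most
a simple pole at `a` and its residue is one of the exponents `-m/2`, `m/2 + 1`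
(`exists_hasSimplePole_of_riccati`, `exists_residue`). Since `Ξ` is even, `-L(-x)` is the
logarithmic derivative belonging to `-κ`; it differs from `L` by `2κ / Ξ`, and the sum of both is
`Ξ' / Ξ`. If the larger exponent occurred at both `a` and `-a`, then `Ξ` would vanish to order
`m + 2` at `a` although `2κ / Ξ` is regular there (`not_upper_of_upper`). So the points where the
larger exponent occurs are never opposite to each other modulo periods, which gives the statement
on `t j + t j'`.

*Global form.* Take the points where the larger exponent occurs, each with multiplicity `m + 1`,
as the list `t`. Subtracting from `L` zeta functions with the same poles leaves a function with
constant additive periods and without poles, hence an affine function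
(`exists_affine_of_removable`). As the quasi-periods of `ζ` are not proportional to the periods
(`not_exists_zetaPeriod_eq_mul`), the number of zeros is `D.N` and the affine function is a
constant `c` (`exists_betheLog`). Integration over a domain gives the product of sigma functions
(`exists_isBetheForm`); conversely such a product for one branch determines `L` everywhere by the
identity theorem (`eventually_eq_betheLog`), so that the multiplicities of the `t j` can be read
off from the residues of `L`.

*Values.* The part of `L` invariant under `x ↦ -x` is `κ / Ξ`; comparing with the product
expression at `x = 0` gives `c` (`tendsto_div`). At a zero `t j` the residues of `L(x)` and
`-L(-x)` are `m/2 + 1` and `-m/2`, so that `2κ / Ξ` has residue `m + 1`, which gives `Ξ'`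
(`hasDerivAt_of_count_ne_zero`) and, after division by `℘'`, `dΞ/dz`. That `℘'` does not vanish
there, and that `Ξ` is a function of `℘`, follows from the addition formula for `σ`
(`weierstrassSigma_add_mul_sub`).
-/

/-! ### Simple poles and Liouville's theorem -/

/-- `f` is meromorphic at `a` with at most a simple pole there, and `ρ` is its residue; `ρ = 0`
means that the singularity is removable. The value `f a` itself plays no role. -/
def HasSimplePole (f : ℂ → ℂ) (a ρ : ℂ) : Prop :=
  ∃ h : ℂ → ℂ, AnalyticAt ℂ h a ∧ ∀ᶠ x in 𝓝[≠] a, f x = ρ / (x - a) + h x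

lemma AnalyticAt.exists_eq_add_sub_mul {m : ℂ → ℂ} {a : ℂ} (hm : AnalyticAt ℂ m a) :
    ∃ k : ℂ → ℂ, AnalyticAt ℂ k a ∧ ∀ x, m x = m a + (x - a) * k x := by
  obtain ⟨p, hp⟩ := hm
  refine ⟨dslope m a, ⟨_, hp.has_fpower_series_dslope_fslope⟩, fun x => ?_⟩
  have := sub_smul_dslope m a x
  simp only [smul_eq_mul] at this
  rw [this]; ring

lemma tendsto_add_const_nhdsNE (a c : ℂ) : Tendsto (fun x => x + c) (𝓝[≠] a) (𝓝[≠] (a + c)) :=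
  ((hasDerivAt_id a).add_const c).tendsto_nhdsNE one_ne_zero

lemma tendsto_neg_nhdsNE (a : ℂ) : Tendsto (fun x => -x) (𝓝[≠] a) (𝓝[≠] (-a)) :=
  (hasDerivAt_neg a).tendsto_nhdsNE (by simp)

namespace HasSimplePole

variable {f g : ℂ → ℂ} {a ρ σ : ℂ}

lemma congr (hf : HasSimplePole f a ρ) (h : ∀ᶠ x in 𝓝[≠] a, g x = f x) :
    HasSimplePole g a ρ := by
  obtain ⟨k, hk, hfk⟩ := hf
  exact ⟨k, hk, by filter_upwards [h, hfk] with x h1 h2; rw [h1, h2]⟩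

lemma of_analyticAt (hf : AnalyticAt ℂ f a) : HasSimplePole f a 0 :=
  ⟨f, hf, by simp⟩

lemma of_eq_div {m : ℂ → ℂ} (hm : AnalyticAt ℂ m a) (h : ∀ᶠ x in 𝓝[≠] a, f x = m x / (x - a)) :
    HasSimplePole f a (m a) := by
  obtain ⟨k, hk, hmk⟩ := hm.exists_eq_add_sub_mul
  refine ⟨k, hk, ?_⟩
  filter_upwards [h, self_mem_nhdsWithin] with x hx hxa
  have : x - a ≠ 0 := sub_ne_zero.2 hxa
  rw [hx, hmk x]
  field_simp

lemma add (hf : HasSimplePole f a ρ) (hg : HasSimplePole g a σ) :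
    HasSimplePole (fun x => f x + g x) a (ρ + σ) := by
  obtain ⟨k, hk, hfk⟩ := hf
  obtain ⟨l, hl, hgl⟩ := hg
  refine ⟨fun x => k x + l x, hk.add hl, ?_⟩
  filter_upwards [hfk, hgl] with x h1 h2
  rw [h1, h2]; ring

lemma const_mul (c : ℂ) (hf : HasSimplePole f a ρ) :
    HasSimplePole (fun x => c * f x) a (c * ρ) := by
  obtain ⟨k, hk, hfk⟩ := hf
  refine ⟨fun x => c * k x, analyticAt_const.mul hk, ?_⟩
  filter_upwards [hfk] with x h1
  rw [h1]; ring

lemma neg (hf : HasSimplePole f a ρ) : HasSimplePole (fun x => -f x) a (-ρ) := by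
  simpa using hf.const_mul (-1)

lemma sub (hf : HasSimplePole f a ρ) (hg : HasSimplePole g a σ) :
    HasSimplePole (fun x => f x - g x) a (ρ - σ) := by
  simpa [sub_eq_add_neg] using hf.add hg.neg

lemma const (c : ℂ) : HasSimplePole (fun _ => c) a 0 := of_analyticAt analyticAt_const

lemma sum {ι : Type*} (s : Finset ι) {F : ι → ℂ → ℂ} {R : ι → ℂ}
    (h : ∀ i ∈ s, HasSimplePole (F i) a (R i)) :
    HasSimplePole (fun x => ∑ i ∈ s, F i x) a (∑ i ∈ s, R i) := by
  classical
  induction s using Finset.induction_on with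
  | empty => simpa using const 0
  | insert i s hi ih =>
    simp only [Finset.sum_insert hi]
    exact (h i (by simp)).add (ih fun j hj => h j (by simp [hj]))

lemma tendsto_sub_mul (hf : HasSimplePole f a ρ) :
    Tendsto (fun x => (x - a) * f x) (𝓝[≠] a) (𝓝 ρ) := by
  obtain ⟨k, hk, hfk⟩ := hf
  have h1 : Tendsto (fun x => ρ + (x - a) * k x) (𝓝 a) (𝓝 (ρ + (a - a) * k a)) :=
    ((continuousAt_const.add ((continuousAt_id.sub continuousAt_const).mul hk.continuousAt)))
  simp only [sub_self, zero_mul, add_zero] at h1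
  refine (h1.mono_left nhdsWithin_le_nhds).congr' ?_
  filter_upwards [hfk, self_mem_nhdsWithin] with x hx hxa
  have : x - a ≠ 0 := sub_ne_zero.2 hxa
  rw [hx]; field_simp

lemma unique (hf : HasSimplePole f a ρ) (hf' : HasSimplePole f a σ) : ρ = σ :=
  tendsto_nhds_unique hf.tendsto_sub_mul hf'.tendsto_sub_mul

lemma meromorphicAt (hf : HasSimplePole f a ρ) : MeromorphicAt f a := by
  obtain ⟨k, hk, hfk⟩ := hf
  have h : MeromorphicAt (fun x => ρ / (x - a) + k x) a :=
    ((MeromorphicAt.const ρ a).div ((MeromorphicAt.id a).sub (MeromorphicAt.const a a))).add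
      hk.meromorphicAt
  exact h.congr (by filter_upwards [hfk] with x hx; rw [hx])

/-- Poles are isolated. -/
lemma eventually_removable (hf : HasSimplePole f a ρ) : ∀ᶠ b in 𝓝[≠] a, HasSimplePole f b 0 := by
  filter_upwards [hf.meromorphicAt.eventually_analyticAt] with b hb using of_analyticAt hb

lemma comp_add (c : ℂ) (hf : HasSimplePole f (a + c) ρ) :
    HasSimplePole (fun x => f (x + c)) a ρ := by
  obtain ⟨k, hk, hfk⟩ := hf
  refine ⟨fun x => k (x + c), hk.comp_of_eq (by fun_prop) rfl, ?_⟩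
  filter_upwards [(tendsto_add_const_nhdsNE a c).eventually hfk] with x hx
  rw [hx]; ring_nf

lemma comp_neg (hf : HasSimplePole f (-a) ρ) : HasSimplePole (fun x => f (-x)) a (-ρ) := by
  obtain ⟨k, hk, hfk⟩ := hf
  refine ⟨fun x => k (-x), hk.comp_of_eq (by fun_prop) rfl, ?_⟩
  filter_upwards [(tendsto_neg_nhdsNE a).eventually hfk, self_mem_nhdsWithin] with x hx hxa
  have : x - a ≠ 0 := sub_ne_zero.2 hxa
  have h2 : -x - -a = -(x - a) := by ring
  rw [hx, h2, div_neg, neg_div]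

end HasSimplePole

/-- A meromorphic solution of a Riccati equation `f' + f² = u` whose right-hand side has at most a
double pole with leading coefficient `A` has at most a simple pole, and its residue is a root of the
indicial equation `ρ (ρ - 1) = A`. -/
theorem exists_hasSimplePole_of_riccati {f u : ℂ → ℂ} {a A : ℂ} (hf : MeromorphicAt f a)
    (h : ∀ᶠ x in 𝓝[≠] a, deriv f x + f x ^ 2 = u x)
    (hu : Tendsto (fun x => (x - a) ^ 2 * u x) (𝓝[≠] a) (𝓝 A)) :
    ∃ ρ, HasSimplePole f a ρ ∧ ρ ^ 2 - ρ = A := by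
  -- Descent on the exponent `n` of a denominator `(x - a) ^ n` of `f`.
  have key : ∀ (n : ℕ) (m : ℂ → ℂ), AnalyticAt ℂ m a →
      (∀ᶠ x in 𝓝[≠] a, f x = m x / (x - a) ^ (n + 1)) →
      ∃ ρ, HasSimplePole f a ρ ∧ ρ ^ 2 - ρ = A := by
    intro n
    induction n with
    | zero =>
      intro m hm hfm
      simp only [zero_add, pow_one] at hfm
      refine ⟨m a, HasSimplePole.of_eq_div hm hfm, ?_⟩
      have h1 : Tendsto (fun x => deriv m x * (x - a) - m x + m x ^ 2) (𝓝[≠] a)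
          (𝓝 (deriv m a * (a - a) - m a + m a ^ 2)) := by
        have : ContinuousAt (fun x => deriv m x * (x - a) - m x + m x ^ 2) a := by
          have h1 := hm.continuousAt
          have h2 := hm.deriv.continuousAt
          fun_prop
        exact this.tendsto.mono_left nhdsWithin_le_nhds
      have h2 := tendsto_nhds_unique hu (h1.congr' ?_)
      · rw [h2]; ring
      filter_upwards [h, eventually_nhdsNE_eventually_nhds_iff.2 hfm, self_mem_nhdsWithin,
        nhdsWithin_le_nhds hm.eventually_analyticAt] with x hx hx2 hxa hmx
      have hxa : x - a ≠ 0 := sub_ne_zero.2 hxa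
      have hd : deriv f x = (deriv m x * (x - a) - m x) / (x - a) ^ 2 := by
        rw [Filter.EventuallyEq.deriv_eq hx2]
        simpa using (hmx.differentiableAt.hasDerivAt.fun_div
          ((hasDerivAt_id x).sub_const a) hxa).deriv
      rw [← hx, hd, hx2.self_of_nhds]
      field_simp
    | succ n ih =>
      intro m hm hfm
      obtain ⟨k, hk, hmk⟩ := hm.exists_eq_add_sub_mul
      have hma : m a = 0 := by
        have h1 : Tendsto (fun x => deriv m x * (x - a) ^ (n + 2)
            - (n + 2) * m x * (x - a) ^ (n + 1) + m x ^ 2) (𝓝[≠] a)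
            (𝓝 (deriv m a * (a - a) ^ (n + 2)
              - (n + 2) * m a * (a - a) ^ (n + 1) + m a ^ 2)) := by
          have : ContinuousAt (fun x => deriv m x * (x - a) ^ (n + 2)
            - (n + 2) * m x * (x - a) ^ (n + 1) + m x ^ 2) a := by
            have h1 := hm.continuousAt
            have h2 := hm.deriv.continuousAt
            fun_prop
          exact this.tendsto.mono_left nhdsWithin_le_nhds
        have h0 : Tendsto (fun x => (x - a) ^ (2 * n + 2) * ((x - a) ^ 2 * u x)) (𝓝[≠] a)
            (𝓝 ((a - a) ^ (2 * n + 2) * A)) := by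
          have : ContinuousAt (fun x : ℂ => (x - a) ^ (2 * n + 2)) a := by fun_prop
          exact (this.tendsto.mono_left nhdsWithin_le_nhds).mul hu
        have h2 := tendsto_nhds_unique h0 (h1.congr' ?_)
        · simpa using h2.symm
        filter_upwards [h, eventually_nhdsNE_eventually_nhds_iff.2 hfm, self_mem_nhdsWithin,
          nhdsWithin_le_nhds hm.eventually_analyticAt] with x hx hx2 hxa hmx
        have hxa : x - a ≠ 0 := sub_ne_zero.2 hxa
        have hd : deriv f x = (deriv m x * (x - a) ^ (n + 2) - m x * ((n + 2) * (x - a) ^ (n + 1)))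
            / ((x - a) ^ (n + 2)) ^ 2 := by
          rw [Filter.EventuallyEq.deriv_eq hx2]
          have := (hmx.differentiableAt.hasDerivAt.fun_div
            (((hasDerivAt_id x).sub_const a).fun_pow (n + 2)) (pow_ne_zero _ hxa)).deriv
          simpa using this
        rw [← hx, hd, hx2.self_of_nhds]
        field_simp
        ring
      refine ih k hk ?_
      filter_upwards [hfm, self_mem_nhdsWithin] with x hx hxa
      have hxa : x - a ≠ 0 := sub_ne_zero.2 hxa
      rw [hx, hmk x, hma]
      field_simp
      ring
  obtain ⟨n, hn⟩ := hf
  refine key n (fun x => (x - a) * ((x - a) ^ n • f x)) (by fun_prop) ?_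
  filter_upwards [self_mem_nhdsWithin] with x hxa
  have hxa : x - a ≠ 0 := sub_ne_zero.2 hxa
  simp only [smul_eq_mul]
  field_simp
  ring

/-- If the logarithmic derivative of a meromorphic function `F` has at most a simple pole, then its
residue is the order of `F`. -/
theorem exists_eq_zpow_mul_of_logDeriv {F H : ℂ → ℂ} {a ρ : ℂ} (hF : MeromorphicAt F a)
    (hF0 : meromorphicOrderAt F a ≠ ⊤) (hH : HasSimplePole H a ρ)
    (h : ∀ᶠ x in 𝓝[≠] a, deriv F x = H x * F x) :
    ∃ n : ℤ, (n : ℂ) = ρ ∧ ∃ g : ℂ → ℂ, AnalyticAt ℂ g a ∧ g a ≠ 0 ∧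
      ∀ᶠ x in 𝓝[≠] a, F x = (x - a) ^ n * g x := by
  obtain ⟨g, hg, hga, hFg⟩ := (meromorphicOrderAt_ne_top_iff hF).1 hF0
  set n := (meromorphicOrderAt F a).untop₀
  refine ⟨n, ?_, g, hg, hga, hFg⟩
  refine HasSimplePole.unique (f := H) (a := a) ⟨fun x => deriv g x / g x, hg.deriv.div hg hga, ?_⟩
    hH
  filter_upwards [h, eventually_nhdsNE_eventually_nhds_iff.2 hFg, self_mem_nhdsWithin,
    nhdsWithin_le_nhds hg.eventually_analyticAt,
    nhdsWithin_le_nhds (hg.continuousAt.eventually_ne hga)] with x hx hx2 hxa hgx hg0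
  have hxa : x - a ≠ 0 := sub_ne_zero.2 hxa
  have hd : deriv F x = (n * (x - a) ^ (n - 1)) * g x + (x - a) ^ n * deriv g x := by
    rw [Filter.EventuallyEq.deriv_eq hx2]
    have h1 := (hasDerivAt_zpow n (x - a) (Or.inl hxa)).comp x ((hasDerivAt_id x).sub_const a)
    have := (h1.fun_mul hgx.differentiableAt.hasDerivAt).deriv
    simpa [Function.comp_def] using this
  rw [hd, hx2.self_of_nhds, zpow_sub_one₀ hxa] at hx
  have hz : (x - a) ^ n ≠ 0 := zpow_ne_zero _ hxa
  simp only [smul_eq_mul] at hx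
  field_simp at hx ⊢
  linear_combination -hx

/-- Liouville's theorem for elliptic functions, in a form that allows additive quasi-periods: a
function with removable singularities only is affine. -/
theorem PeriodPair.exists_affine_of_removable (L : PeriodPair) {f k : ℂ → ℂ}
    (h0 : ∀ a, HasSimplePole f a 0)
    (hper : ∀ w ∈ L.lattice, ∀ a, ∀ᶠ x in 𝓝[≠] a, f (x + w) = f x + k w) :
    ∃ A B : ℂ, (∀ w ∈ L.lattice, k w = A * w) ∧ ∀ a, ∀ᶠ x in 𝓝[≠] a, f x = A * x + B := by
  -- The punctured limits of `f` form an entire function, whose derivative is elliptic.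
  obtain ⟨F, hF, hfF⟩ : ∃ F : ℂ → ℂ, (∀ a, AnalyticAt ℂ F a) ∧
      ∀ a, ∀ᶠ x in 𝓝[≠] a, f x = F x := by
    have hlim : ∀ a, ∃ h : ℂ → ℂ, AnalyticAt ℂ h a ∧ (∀ᶠ x in 𝓝[≠] a, f x = h x) ∧
        ∀ᶠ x in 𝓝 a, limUnder (𝓝[≠] x) f = h x := by
      intro a
      obtain ⟨h, hh, hfh⟩ := h0 a
      simp only [zero_div, zero_add] at hfh
      refine ⟨h, hh, hfh, ?_⟩
      have h1 : ∀ᶠ x in 𝓝[≠] a, limUnder (𝓝[≠] x) f = h x := by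
        filter_upwards [eventually_nhdsNE_eventually_nhds_iff.2 hfh,
          nhdsWithin_le_nhds hh.eventually_analyticAt] with x hx hhx
        refine Tendsto.limUnder_eq ?_
        refine (hhx.continuousAt.tendsto.mono_left nhdsWithin_le_nhds).congr' ?_
        filter_upwards [nhdsWithin_le_nhds hx] with y hy using hy.symm
      have h2 : limUnder (𝓝[≠] a) f = h a := by
        refine Tendsto.limUnder_eq ?_
        refine (hh.continuousAt.tendsto.mono_left nhdsWithin_le_nhds).congr' ?_
        filter_upwards [hfh] with y hy using hy.symm
      rw [eventually_nhdsWithin_iff] at h1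
      filter_upwards [h1] with x hx
      by_cases hxa : x = a
      · rw [hxa, h2]
      · exact hx hxa
    refine ⟨fun a => limUnder (𝓝[≠] a) f, fun a => ?_, fun a => ?_⟩
    · obtain ⟨h, hh, -, h2⟩ := hlim a
      exact hh.congr (by filter_upwards [h2] with x hx using hx.symm)
    · obtain ⟨h, -, h1, h2⟩ := hlim a
      filter_upwards [h1, nhdsWithin_le_nhds h2] with x hx hx2
      rw [hx, hx2]
  have hd : Differentiable ℂ F := fun a => (hF a).differentiableAt
  have hFper : ∀ w ∈ L.lattice, ∀ x, F (x + w) = F x + k w := by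
    intro w hw x
    have hc1 : Tendsto (fun y => F (y + w)) (𝓝[≠] x) (𝓝 (F (x + w))) :=
      ((hd.continuous.comp (continuous_add_const w)).tendsto x).mono_left nhdsWithin_le_nhds
    have hc2 : Tendsto (fun y => F y + k w) (𝓝[≠] x) (𝓝 (F x + k w)) :=
      ((hd.continuous.add continuous_const).tendsto x).mono_left nhdsWithin_le_nhds
    refine tendsto_nhds_unique hc1 (hc2.congr' ?_)
    filter_upwards [hper w hw x, hfF x, (tendsto_add_const_nhdsNE x w).eventually (hfF (x + w))]
      with y h1 h2 h3
    rw [← h2, ← h1, h3]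
  have hdF : Differentiable ℂ (deriv F) := fun a => (hF a).deriv.differentiableAt
  have hdper : ∀ z, ∀ w ∈ L.lattice, deriv F (z + w) = deriv F z := by
    intro z w hw
    rw [← deriv_comp_add_const]
    have : (fun x => F (x + w)) = fun x => F x + k w := funext (hFper w hw)
    rw [this, deriv_add_const]
  have hconst : ∀ x, deriv F x = deriv F 0 := fun x =>
    hdF.apply_eq_apply_of_bounded (IsZLattice.isCompact_range_of_periodic L.lattice _
      hdF.continuous hdper).isBounded x 0
  have haff : ∀ x, F x = deriv F 0 * x + F 0 := by
    intro x
    have h1 : ∀ y, deriv (fun y => F y - deriv F 0 * y) y = 0 := by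
      intro y
      have := ((hd y).hasDerivAt.sub ((hasDerivAt_id y).const_mul (deriv F 0))).deriv
      simp only [id] at this
      rw [show (fun y => F y - deriv F 0 * y) = (F - fun y => deriv F 0 * y) from rfl, this,
        hconst y]
      ring
    have h2 := is_const_of_deriv_eq_zero (by fun_prop) h1 x 0
    simp only [mul_zero, sub_zero] at h2
    linear_combination h2
  refine ⟨deriv F 0, F 0, fun w hw => ?_, fun a => ?_⟩
  · have := hFper w hw 0
    rw [zero_add, haff w] at this
    linear_combination -this
  · filter_upwards [hfF a] with x hx
    rw [hx, haff x]

/-- An elliptic function with removable singularities only is constant. -/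
theorem PeriodPair.exists_const_of_removable (L : PeriodPair) {f : ℂ → ℂ}
    (h0 : ∀ a, HasSimplePole f a 0)
    (hper : ∀ w ∈ L.lattice, ∀ a, ∀ᶠ x in 𝓝[≠] a, f (x + w) = f x) :
    ∃ C : ℂ, ∀ a, ∀ᶠ x in 𝓝[≠] a, f x = C := by
  obtain ⟨A, B, hA, hB⟩ := L.exists_affine_of_removable (k := fun _ => 0) h0 (by simpa using hper)
  have hA0 : A = 0 := by
    have := hA _ L.ω₁_mem_lattice
    have hne : L.ω₁ ≠ 0 := by simpa using L.indep.ne_zero 0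
    simpa [hne, eq_comm] using this
  exact ⟨B, by simpa [hA0] using hB⟩

/-! ### The Weierstrass sigma function -/

/-- The primary factor `(1 - u) exp (u + u² / 2)`. -/
noncomputable def primaryFactor (u : ℂ) : ℂ := (1 - u) * Complex.exp (u + u ^ 2 / 2)

lemma hasDerivAt_primaryFactor (u : ℂ) :
    HasDerivAt primaryFactor (-u ^ 2 * Complex.exp (u + u ^ 2 / 2)) u := by
  have h1 : HasDerivAt (fun u : ℂ => u + u ^ 2 / 2) (1 + u) u := by
    have := (hasDerivAt_id u).fun_add (((hasDerivAt_id u).fun_pow 2).div_const 2)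
    simpa using this
  have h2 := ((hasDerivAt_id u).const_sub 1).fun_mul h1.cexp
  simp only [id] at h2
  refine h2.congr_deriv ?_
  ring

lemma primaryFactor_zero : primaryFactor 0 = 1 := by simp [primaryFactor]

lemma primaryFactor_eq_zero_iff {u : ℂ} : primaryFactor u = 0 ↔ u = 1 := by
  rw [primaryFactor, mul_eq_zero, or_iff_left (Complex.exp_ne_zero _), sub_eq_zero, eq_comm]

lemma norm_primaryFactor_sub_one_le {u : ℂ} (hu : ‖u‖ ≤ 1 / 2) :
    ‖primaryFactor u - 1‖ ≤ Real.exp 1 * ‖u‖ ^ 3 := by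
  have h := (convex_closedBall (0 : ℂ) ‖u‖).norm_image_sub_le_of_norm_hasDerivWithin_le
    (f := primaryFactor) (C := Real.exp 1 * ‖u‖ ^ 2) (x := 0) (y := u)
    (fun x _ => (hasDerivAt_primaryFactor x).hasDerivWithinAt) ?_ (by simp) (by simp)
  · rw [primaryFactor_zero, sub_zero] at h
    exact h.trans_eq (by ring)
  · intro x hx
    have hx : ‖x‖ ≤ ‖u‖ := by simpa using hx
    rw [norm_mul, norm_neg, norm_pow, mul_comm]
    gcongr
    rw [Complex.norm_exp]
    gcongr
    refine (Complex.re_le_norm _).trans ((norm_add_le _ _).trans ?_)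
    rw [norm_div, norm_pow, Complex.norm_ofNat]
    have := norm_nonneg x
    nlinarith

namespace PeriodPair

variable (L : PeriodPair)

lemma weierstrassSigma_eq (z : ℂ) :
    L.weierstrassSigma z = z * ∏' w : L.lattice, primaryFactor (z / w) := by
  simp only [weierstrassSigma, primaryFactor]
  congr! 5
  rw [div_pow, div_div, mul_comm]

lemma eventually_cofinite_le_norm (R : ℝ) : ∀ᶠ w : L.lattice in cofinite, R ≤ ‖(w : ℂ)‖ := by
  refine (isCompact_iff_finite.mp (isCompact_closedBall (0 : L.lattice) R)).subset ?_
  intro w hw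
  simp only [Set.mem_ofPred_eq, Set.mem_compl_iff, not_le] at hw
  simpa using hw.le

lemma summable_norm_rpow_neg_three : Summable fun w : L.lattice => ‖w‖ ^ (-3 : ℝ) :=
  ZLattice.summable_norm_rpow _ _ (by simp; norm_num)

lemma norm_primaryFactor_div_sub_one_le {R : ℝ} {z w : ℂ} (hz : ‖z‖ ≤ R) (hR : 0 < R)
    (hw : 2 * R ≤ ‖w‖) :
    ‖primaryFactor (z / w) - 1‖ ≤ Real.exp 1 * R ^ 3 * ‖w‖ ^ (-3 : ℝ) := by
  have hw0 : 0 < ‖w‖ := by linarith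
  have h1 : ‖z / w‖ ≤ 1 / 2 := by
    rw [norm_div, div_le_iff₀ hw0]; linarith
  refine (norm_primaryFactor_sub_one_le h1).trans ?_
  rw [norm_div, div_pow, Real.rpow_neg hw0.le, mul_assoc, ← div_eq_mul_inv]
  gcongr
  norm_cast

lemma hasProdLocallyUniformlyOn_primaryFactor (R : ℝ) :
    HasProdLocallyUniformlyOn (fun (w : L.lattice) z => primaryFactor (z / w))
      (fun z => ∏' w : L.lattice, primaryFactor (z / w)) (Metric.ball 0 R) := by
  rcases le_or_gt R 0 with hR | hR
  · rw [Metric.ball_eq_empty.2 hR, hasProdLocallyUniformlyOn_iff_tendstoLocallyUniformlyOn]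
    exact fun _ _ x hx => hx.elim
  have := Summable.hasProdLocallyUniformlyOn_one_add (f := fun (w : L.lattice) z =>
    primaryFactor (z / w) - 1) (K := Metric.ball 0 R) Metric.isOpen_ball
    (L.summable_norm_rpow_neg_three.mul_left (Real.exp 1 * R ^ 3)) ?_ ?_
  · simpa using this
  · filter_upwards [L.eventually_cofinite_le_norm (2 * R)] with w hw z hz
    exact norm_primaryFactor_div_sub_one_le (by simpa using (Metric.mem_ball.1 hz).le) hR hw
  · intro w
    refine Continuous.continuousOn ?_
    unfold primaryFactor
    fun_prop

lemma differentiable_primaryFactor : Differentiable ℂ primaryFactor :=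
  fun u => (hasDerivAt_primaryFactor u).differentiableAt

lemma differentiable_tprod_primaryFactor :
    Differentiable ℂ fun z => ∏' w : L.lattice, primaryFactor (z / w) := by
  intro z
  have h := hasProdLocallyUniformlyOn_iff_tendstoLocallyUniformlyOn.1
    (L.hasProdLocallyUniformlyOn_primaryFactor (‖z‖ + 1))
  refine (h.differentiableOn (.of_forall fun s => ?_) Metric.isOpen_ball).differentiableAt
    (Metric.isOpen_ball.mem_nhds (by simp))
  refine DifferentiableOn.fun_finsetProd fun w _ => ?_
  exact (differentiable_primaryFactor.comp (differentiable_id.div_const _)).differentiableOn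

lemma differentiable_weierstrassSigma : Differentiable ℂ L.weierstrassSigma := by
  rw [funext L.weierstrassSigma_eq]
  exact differentiable_id.mul L.differentiable_tprod_primaryFactor

lemma summable_norm_primaryFactor_sub_one (z : ℂ) :
    Summable fun w : L.lattice => ‖primaryFactor (z / w) - 1‖ := by
  refine (L.summable_norm_rpow_neg_three.mul_left
    (Real.exp 1 * (‖z‖ + 1) ^ 3)).of_norm_bounded_eventually ?_
  filter_upwards [L.eventually_cofinite_le_norm (2 * (‖z‖ + 1))] with w hw
  rw [norm_norm]
  exact norm_primaryFactor_div_sub_one_le (by linarith) (by positivity) hw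

lemma tprod_primaryFactor_ne_zero {z : ℂ} (hz : z ∈ L.lattice → z = 0) :
    ∏' w : L.lattice, primaryFactor (z / w) ≠ 0 := by
  have := tprod_one_add_ne_zero_of_summable (f := fun w : L.lattice => primaryFactor (z / w) - 1)
    ?_ (L.summable_norm_primaryFactor_sub_one z)
  · simpa using this
  · intro w
    rw [add_sub_cancel, Ne, primaryFactor_eq_zero_iff]
    intro h
    by_cases hw : (w : ℂ) = 0
    · simp [hw] at h
    · rw [div_eq_one_iff_eq hw] at h
      exact hw (h ▸ hz (h ▸ w.2))

lemma weierstrassSigma_eq_zero_iff {z : ℂ} : L.weierstrassSigma z = 0 ↔ z ∈ L.lattice := by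
  rw [L.weierstrassSigma_eq, mul_eq_zero]
  constructor
  · rintro (rfl | h)
    · exact zero_mem _
    · by_contra hz
      exact L.tprod_primaryFactor_ne_zero (fun h => absurd h hz) h
  · intro hz
    by_cases h0 : z = 0
    · exact Or.inl h0
    · exact Or.inr (tprod_of_exists_eq_zero ⟨⟨z, hz⟩, by simp [primaryFactor_eq_zero_iff, h0]⟩)

@[simp] lemma weierstrassSigma_neg (z : ℂ) : L.weierstrassSigma (-z) = -L.weierstrassSigma z := by
  rw [L.weierstrassSigma_eq, L.weierstrassSigma_eq, ← (Equiv.neg L.lattice).tprod_eq]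
  simp

end PeriodPair

/-! ### The Weierstrass zeta function -/

namespace PeriodPair

variable (L : PeriodPair)

lemma isOpen_compl_lattice : IsOpen (L.lattice : Set ℂ)ᶜ := L.isClosed_lattice.isOpen_compl

lemma isPreconnected_compl_lattice : IsPreconnected (L.lattice : Set ℂ)ᶜ :=
  (Set.Countable.isConnected_compl_of_one_lt_rank (by simp)
    (countable_of_Lindelof_of_discrete (X := L.lattice))).2

lemma eventually_notMem_lattice (a : ℂ) : ∀ᶠ x in 𝓝[≠] a, x ∉ L.lattice := by
  filter_upwards [self_mem_nhdsWithin,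
    nhdsWithin_le_nhds (L.compl_lattice_sdiff_singleton_mem_nhds a)] with x hx hx2 hx3
  exact hx2 ⟨hx3, hx⟩

lemma eventually_sub_notMem_lattice (a p : ℂ) : ∀ᶠ x in 𝓝[≠] a, x - p ∉ L.lattice := by
  simpa [sub_eq_add_neg] using
    (tendsto_add_const_nhdsNE a (-p)).eventually (L.eventually_notMem_lattice (a + -p))

lemma add_mem_lattice_iff {x w : ℂ} (hw : w ∈ L.lattice) : x + w ∈ L.lattice ↔ x ∈ L.lattice :=
  L.lattice.add_mem_iff_left hw

lemma logDeriv_primaryFactor_div {z w : ℂ} (hzw : z ≠ w) :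
    logDeriv (fun z => primaryFactor (z / w)) z = z ^ 2 / (w ^ 2 * (z - w)) := by
  by_cases hw : w = 0
  · simp [hw]
  have hd : HasDerivAt (fun z => primaryFactor (z / w))
      ((-(z / w) ^ 2 * Complex.exp (z / w + (z / w) ^ 2 / 2)) * (1 / w)) z :=
    HasDerivAt.comp z (h₂ := primaryFactor) (h := fun z => z / w) (hasDerivAt_primaryFactor (z / w))
      ((hasDerivAt_id z).div_const w)
  rw [logDeriv_apply, hd.deriv, primaryFactor]
  have h1 : z - w ≠ 0 := sub_ne_zero.2 hzw
  have h2 : 1 - z / w ≠ 0 := by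
    rw [sub_ne_zero, ne_comm, Ne, div_eq_one_iff_eq hw]; exact hzw
  have h3 : w - z ≠ 0 := sub_ne_zero.2 hzw.symm
  have h4 := Complex.exp_ne_zero (z / w + (z / w) ^ 2 / 2)
  field_simp
  ring

lemma hasSumLocallyUniformly_zetaSummand :
    HasSumLocallyUniformly (fun (w : L.lattice) (z : ℂ) => z ^ 2 / ((w : ℂ) ^ 2 * (z - w)))
      (fun z => ∑' w : L.lattice, z ^ 2 / ((w : ℂ) ^ 2 * (z - w))) := by
  refine L.hasSumLocallyUniformly_aux _ (u := fun r w => 2 * r ^ 2 * ‖w‖ ^ (-3 : ℝ))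
    (fun _ _ => L.summable_norm_rpow_neg_three.mul_left _) fun r hr =>
    Filter.eventually_atTop.mpr ⟨2 * r, ?_⟩
  rintro _ h z hz w rfl
  have hw : 0 < ‖(w : ℂ)‖ := by linarith
  have h1 : ‖(w : ℂ)‖ / 2 ≤ ‖z - w‖ := by
    rw [norm_sub_rev]
    exact .trans (by linarith) (norm_sub_norm_le _ _)
  rw [norm_div, norm_mul, norm_pow, norm_pow, Real.rpow_neg (norm_nonneg _), ← div_eq_mul_inv,
    show ‖w‖ = ‖(w : ℂ)‖ from rfl]
  calc ‖z‖ ^ 2 / (‖(w : ℂ)‖ ^ 2 * ‖z - w‖) ≤ r ^ 2 / (‖(w : ℂ)‖ ^ 2 * (‖(w : ℂ)‖ / 2)) := by gcongr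
    _ = 2 * r ^ 2 / ‖(w : ℂ)‖ ^ (3 : ℝ) := by
      norm_cast
      field_simp

lemma weierstrassZeta_eq_logDeriv {z : ℂ} (hz : z ≠ 0)
    (hP : ∏' w : L.lattice, primaryFactor (z / w) ≠ 0) :
    L.weierstrassZeta z =
      1 / z + logDeriv (fun z => ∏' w : L.lattice, primaryFactor (z / w)) z := by
  have h := logDeriv_mul (f := fun z => z) (g := fun z => ∏' w : L.lattice, primaryFactor (z / w)) z
    hz hP differentiableAt_fun_id (L.differentiable_tprod_primaryFactor z)
  rw [weierstrassZeta, ← logDeriv_apply, funext L.weierstrassSigma_eq, h, logDeriv_id']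

lemma weierstrassZeta_eq {z : ℂ} (hz : z ∉ L.lattice) :
    L.weierstrassZeta z = 1 / z + ∑' w : L.lattice, z ^ 2 / ((w : ℂ) ^ 2 * (z - w)) := by
  have hzw : ∀ w : L.lattice, z ≠ w := fun w h => hz (h ▸ w.2)
  have hz0 : z ≠ 0 := fun h => hz (h ▸ zero_mem _)
  have hP := L.tprod_primaryFactor_ne_zero (z := z) (fun h => absurd h hz)
  have h1 : logDeriv (fun z => ∏' w : L.lattice, primaryFactor (z / w)) z =
      ∑' w : L.lattice, logDeriv (fun z => primaryFactor (z / w)) z := by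
    refine logDeriv_tprod_eq_tsum (f := fun (w : L.lattice) z => primaryFactor (z / w))
      (s := Metric.ball 0 (‖z‖ + 1)) Metric.isOpen_ball (by simp) (fun w => ?_) (fun w => ?_) ?_
      ⟨_, L.hasProdLocallyUniformlyOn_primaryFactor _⟩ hP
    · rw [Ne, primaryFactor_eq_zero_iff]
      intro h
      by_cases hw : (w : ℂ) = 0
      · simp [hw] at h
      · exact hzw w ((div_eq_one_iff_eq hw).1 h)
    · exact (differentiable_primaryFactor.comp (differentiable_id.div_const _)).differentiableOn
    · simp_rw [fun w : L.lattice => logDeriv_primaryFactor_div (hzw w)]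
      exact (L.hasSumLocallyUniformly_zetaSummand.hasSum (x := z)).summable
  simp_rw [fun w : L.lattice => logDeriv_primaryFactor_div (hzw w)] at h1
  rw [← h1, L.weierstrassZeta_eq_logDeriv hz0 hP]

lemma hasDerivAt_weierstrassZeta {z : ℂ} (hz : z ∉ L.lattice) :
    HasDerivAt L.weierstrassZeta (-L.weierstrassP z) z := by
  have hz0 : z ≠ 0 := fun h => hz (h ▸ zero_mem _)
  have hu := L.hasSumLocallyUniformly_zetaSummand.tendstoLocallyUniformlyOn
    (s := (L.lattice : Set ℂ)ᶜ)
  have hd : ∀ w : L.lattice, ∀ x ∉ L.lattice, HasDerivAt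
      (fun z : ℂ => z ^ 2 / ((w : ℂ) ^ 2 * (z - w)))
      (-(1 / (x - w) ^ 2 - 1 / (w : ℂ) ^ 2) + if w = 0 then 1 / x ^ 2 else 0) x := by
    intro w x hx
    by_cases hw : w = 0
    · subst hw
      simpa using hasDerivAt_const x (0 : ℂ)
    · have hw0 : (w : ℂ) ≠ 0 := by simpa using hw
      have hxw : x - w ≠ 0 := sub_ne_zero.2 fun h => hx (h ▸ w.2)
      have := ((hasDerivAt_id x).fun_pow 2).fun_div
        (((hasDerivAt_id x).sub_const (w : ℂ)).const_mul ((w : ℂ) ^ 2)) (by simpa using ⟨hw, hxw⟩)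
      simp only [id] at this
      refine this.congr_deriv ?_
      rw [if_neg hw]
      field_simp
      ring
  have hdiff : ∀ᶠ s : Finset L.lattice in atTop, DifferentiableOn ℂ
      (fun z => ∑ w ∈ s, z ^ 2 / ((w : ℂ) ^ 2 * (z - w))) (L.lattice : Set ℂ)ᶜ :=
    .of_forall fun s => .fun_sum fun w _ x hx => (hd w x hx).differentiableAt.differentiableWithinAt
  have h1 := (hu.deriv hdiff L.isOpen_compl_lattice).tendsto_at hz
  have h2 := (hu.differentiableOn hdiff L.isOpen_compl_lattice).differentiableAt
    (L.isOpen_compl_lattice.mem_nhds hz)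
  have h3 : HasSum (fun w : L.lattice => -(1 / (z - w) ^ 2 - 1 / (w : ℂ) ^ 2) +
      if w = 0 then 1 / z ^ 2 else 0) (-L.weierstrassP z + 1 / z ^ 2) := by
    refine (L.hasSum_weierstrassP z).neg.add ?_
    have := hasSum_ite_eq (0 : L.lattice) (1 / z ^ 2)
    exact this
  have h4 := tendsto_nhds_unique (h1.congr fun s => ?_) h3
  · have h5 : HasDerivAt (fun z : ℂ => 1 / z) (-1 / z ^ 2) z := by
      simpa [neg_div] using hasDerivAt_inv hz0
    have h6 := h5.fun_add h2.hasDerivAt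
    rw [h4] at h6
    refine (h6.congr_of_eventuallyEq ?_).congr_deriv (by ring)
    filter_upwards [L.isOpen_compl_lattice.mem_nhds hz] with x hx using L.weierstrassZeta_eq hx
  · exact (HasDerivAt.fun_sum fun w _ => hd w z hz).deriv

@[simp] lemma weierstrassZeta_neg (z : ℂ) : L.weierstrassZeta (-z) = -L.weierstrassZeta z := by
  have h : (fun z => L.weierstrassSigma (-z)) = fun z => -L.weierstrassSigma z :=
    funext L.weierstrassSigma_neg
  have h2 : deriv L.weierstrassSigma (-z) = deriv L.weierstrassSigma z := by
    have := deriv_comp_neg L.weierstrassSigma z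
    rw [h, deriv.fun_neg] at this
    exact neg_injective this.symm
  rw [weierstrassZeta, weierstrassZeta, h2, L.weierstrassSigma_neg, div_neg]

lemma weierstrassZeta_of_mem {z : ℂ} (hz : z ∈ L.lattice) : L.weierstrassZeta z = 0 := by
  rw [weierstrassZeta, L.weierstrassSigma_eq_zero_iff.2 hz, div_zero]

/-- The quasi-period `ζ(z + w) - ζ(z)` of the Weierstrass zeta function. -/
noncomputable def zetaPeriod (w : ℂ) : ℂ :=
  L.weierstrassZeta (L.ω₁ / 2 + w) - L.weierstrassZeta (L.ω₁ / 2)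

lemma weierstrassZeta_add {z w : ℂ} (hw : w ∈ L.lattice) (hz : z ∉ L.lattice) :
    L.weierstrassZeta (z + w) = L.weierstrassZeta z + L.zetaPeriod w := by
  have hd : ∀ x ∉ L.lattice, HasDerivAt (fun x => L.weierstrassZeta (x + w))
      (-L.weierstrassP x) x := by
    intro x hx
    have h := (L.hasDerivAt_weierstrassZeta
      (mt (L.add_mem_lattice_iff hw).1 hx)).comp_add_const x w
    rwa [L.weierstrassP_add_coe x ⟨w, hw⟩] at h
  refine L.isOpen_compl_lattice.eqOn_of_deriv_eq (x := L.ω₁ / 2) L.isPreconnected_compl_lattice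
    (f := fun x => L.weierstrassZeta (x + w)) (g := fun x => L.weierstrassZeta x + L.zetaPeriod w)
    (fun x hx => (hd x hx).differentiableAt.differentiableWithinAt)
    (fun x hx => ((L.hasDerivAt_weierstrassZeta hx).add_const
      _).differentiableAt.differentiableWithinAt)
    (fun x hx => ?_) L.ω₁_div_two_notMem_lattice ?_ hz
  · rw [(hd x hx).deriv, ((L.hasDerivAt_weierstrassZeta hx).add_const _).deriv]
  · simp [zetaPeriod]

/-- At a half period `h`, the quasi-period of `2 h` is `2 ζ(h)`; this includes `h` in the lattice
only when `h = 0`, as `ζ` vanishes by convention at its poles. -/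
lemma weierstrassZeta_add_sub (h : ℂ) (hh : 2 * h ∈ L.lattice) (h0 : h ∈ L.lattice → h = 0) {z : ℂ}
    (hz : z + h ∉ L.lattice) :
    L.weierstrassZeta (z + h) - L.weierstrassZeta h
      = L.weierstrassZeta (z - h) + L.weierstrassZeta h := by
  by_cases hL : h ∈ L.lattice
  · rw [h0 hL]; simp [L.weierstrassZeta_of_mem (zero_mem _)]
  have h1 := L.weierstrassZeta_add hh (z := -h) (by simpa using hL)
  have h2 := L.weierstrassZeta_add hh (z := z - h) (by
    rwa [← L.add_mem_lattice_iff hh, show z - h + 2 * h = z + h by ring])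
  rw [show -h + 2 * h = h by ring, L.weierstrassZeta_neg] at h1
  rw [show z - h + 2 * h = z + h by ring] at h2
  linear_combination h2 - h1

lemma analyticAt_weierstrassZeta {z : ℂ} (hz : z ∉ L.lattice) :
    AnalyticAt ℂ L.weierstrassZeta z :=
  DifferentiableOn.analyticAt (s := (L.lattice : Set ℂ)ᶜ)
    (fun _ hx => (L.hasDerivAt_weierstrassZeta hx).differentiableAt.differentiableWithinAt)
    (L.isOpen_compl_lattice.mem_nhds hz)

open Classical in
lemma hasSimplePole_weierstrassZeta (a : ℂ) :
    HasSimplePole L.weierstrassZeta a (if a ∈ L.lattice then 1 else 0) := by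
  split_ifs with ha
  · have h0 : HasSimplePole L.weierstrassZeta 0 1 := by
      set P := fun z => ∏' w : L.lattice, primaryFactor (z / w)
      have hP : AnalyticAt ℂ P 0 := L.differentiable_tprod_primaryFactor.analyticAt 0
      have hP0 : P 0 ≠ 0 := L.tprod_primaryFactor_ne_zero (fun _ => rfl)
      refine ⟨fun z => deriv P z / P z, hP.deriv.div hP hP0, ?_⟩
      filter_upwards [nhdsWithin_le_nhds (hP.continuousAt.eventually_ne hP0), self_mem_nhdsWithin]
        with z hz hz0
      rw [L.weierstrassZeta_eq_logDeriv hz0 hz, sub_zero, logDeriv_apply]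
    have h1 : HasSimplePole (fun x => L.weierstrassZeta (x + -a)) a 1 :=
      HasSimplePole.comp_add (-a) (by simpa using h0)
    have h2 := h1.add (HasSimplePole.const (a := a) (L.zetaPeriod a))
    rw [add_zero] at h2
    refine h2.congr ?_
    filter_upwards [L.eventually_sub_notMem_lattice a a] with x hx
    have := L.weierstrassZeta_add ha hx
    rw [sub_add_cancel] at this
    rw [this, sub_eq_add_neg]
  · exact HasSimplePole.of_analyticAt (L.analyticAt_weierstrassZeta ha)

open Classical in
lemma hasSimplePole_weierstrassZeta_sub (p a : ℂ) :
    HasSimplePole (fun x => L.weierstrassZeta (x - p)) a (if a - p ∈ L.lattice then 1 else 0) := by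
  simpa [sub_eq_add_neg] using
    HasSimplePole.comp_add (-p) (L.hasSimplePole_weierstrassZeta (a + -p))

/-- Quasi-periodicity of the sigma function. -/
lemma exists_weierstrassSigma_add {w : ℂ} (hw : w ∈ L.lattice) :
    ∃ C : ℂ, C ≠ 0 ∧ ∀ z, L.weierstrassSigma (z + w) =
      C * Complex.exp (L.zetaPeriod w * z) * L.weierstrassSigma z := by
  have hexp : ∀ x, HasDerivAt (fun z => Complex.exp (L.zetaPeriod w * z))
      (Complex.exp (L.zetaPeriod w * x) * L.zetaPeriod w) x := fun x => by
    simpa using ((hasDerivAt_id x).const_mul (L.zetaPeriod w)).cexp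
  have hσ := L.differentiable_weierstrassSigma
  obtain ⟨C, hC, h⟩ := (logDeriv_eqOn_iff (f := fun z => L.weierstrassSigma (z + w))
    (g := fun z => Complex.exp (L.zetaPeriod w * z) * L.weierstrassSigma z)
    (s := (L.lattice : Set ℂ)ᶜ) (hσ.comp (differentiable_id.add_const w)).differentiableOn
    ((Differentiable.mul (fun x => (hexp x).differentiableAt) hσ).differentiableOn)
    L.isOpen_compl_lattice L.isPreconnected_compl_lattice (fun x hx => by
      simpa [L.weierstrassSigma_eq_zero_iff] using hx) (fun x hx => by
      simpa [L.weierstrassSigma_eq_zero_iff, L.add_mem_lattice_iff hw] using hx)).1 (fun x hx => by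
      have h1 : L.weierstrassSigma x ≠ 0 := by simpa [L.weierstrassSigma_eq_zero_iff] using hx
      rw [logDeriv_mul (f := fun z => Complex.exp (L.zetaPeriod w * z)) _ (Complex.exp_ne_zero _) h1
          (hexp x).differentiableAt (hσ x),
        logDeriv_apply (fun z => L.weierstrassSigma (z + w)), deriv_comp_add_const,
        logDeriv_apply (fun z => Complex.exp (L.zetaPeriod w * z)), (hexp x).deriv,
        mul_div_cancel_left₀ _ (Complex.exp_ne_zero _)]
      have := L.weierstrassZeta_add hw hx
      simp only [weierstrassZeta] at this
      rw [this, logDeriv_apply, add_comm])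
  refine ⟨C, hC, fun z => ?_⟩
  by_cases hz : z ∈ L.lattice
  · rw [L.weierstrassSigma_eq_zero_iff.2 hz,
      L.weierstrassSigma_eq_zero_iff.2 ((L.add_mem_lattice_iff hw).2 hz), mul_zero]
  · have := h hz
    simpa [mul_assoc] using this

end PeriodPair

/-! ### Parity, the addition formula and values of `℘` -/

lemma ContinuousAt.eq_of_eventually_nhdsNE {f g : ℂ → ℂ} {a : ℂ} (hf : ContinuousAt f a)
    (hg : ContinuousAt g a) (h : ∀ᶠ x in 𝓝[≠] a, f x = g x) : f a = g a :=
  tendsto_nhds_unique ((hf.tendsto.mono_left nhdsWithin_le_nhds).congr' h)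
    (hg.tendsto.mono_left nhdsWithin_le_nhds)

namespace PeriodPair

variable (L : PeriodPair)

lemma exists_weierstrassP_eq {a : ℂ} (ha : a ∈ L.lattice) :
    ∃ k : ℂ → ℂ, AnalyticAt ℂ k a ∧ ∀ x, L.weierstrassP x = 1 / (x - a) ^ 2 + k x := by
  refine ⟨fun x => L.weierstrassPExcept a x - 1 / a ^ 2,
    (L.analyticAt_weierstrassPExcept a).sub analyticAt_const, fun x => ?_⟩
  rw [← L.weierstrassPExcept_add ⟨a, ha⟩ x]
  ring

open Classical in
lemma tendsto_sq_mul_weierstrassP (p a : ℂ) :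
    Tendsto (fun x => (x - a) ^ 2 * L.weierstrassP (x - p)) (𝓝[≠] a)
      (𝓝 (if a - p ∈ L.lattice then 1 else 0)) := by
  split_ifs with h
  · obtain ⟨k, hk, hPk⟩ := L.exists_weierstrassP_eq h
    have hk' : ContinuousAt (fun x => k (x - p)) a :=
      ContinuousAt.comp (f := fun x => x - p) hk.continuousAt (by fun_prop)
    have hc : ContinuousAt (fun x => 1 + (x - a) ^ 2 * k (x - p)) a := by fun_prop
    have h1 := hc.tendsto.mono_left (nhdsWithin_le_nhds (s := {a}ᶜ))
    simp only [sub_self, ne_eq, OfNat.ofNat_ne_zero, not_false_eq_true, zero_pow, zero_mul,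
      add_zero] at h1
    refine h1.congr' ?_
    filter_upwards [self_mem_nhdsWithin] with x hx
    have : x - a ≠ 0 := sub_ne_zero.2 hx
    rw [hPk, sub_sub_sub_cancel_right]
    field_simp
  · have hP : ContinuousAt (fun x => L.weierstrassP (x - p)) a :=
      ContinuousAt.comp (f := fun x => x - p) (L.analyticOnNhd_weierstrassP _ h).continuousAt
        (by fun_prop)
    have hc : ContinuousAt (fun x => (x - a) ^ 2 * L.weierstrassP (x - p)) a := by fun_prop
    simpa using hc.tendsto.mono_left (nhdsWithin_le_nhds (s := {a}ᶜ))

variable {L} in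
/-- An even elliptic function whose only pole is at most simple and lies at the periods is
constant: the residue at `0` vanishes by parity. -/
lemma exists_const_of_even {F : ℂ → ℂ} {ρ : ℂ} (hana : ∀ a ∉ L.lattice, AnalyticAt ℂ F a)
    (hper : ∀ w ∈ L.lattice, ∀ x ∉ L.lattice, F (x + w) = F x)
    (heven : ∀ x ∉ L.lattice, F (-x) = F x) (h0 : HasSimplePole F 0 ρ) :
    ∃ C, ∀ x ∉ L.lattice, F x = C := by
  have hρ : ρ = 0 := by
    have h1 : HasSimplePole (fun x => F (-x)) 0 (-ρ) := HasSimplePole.comp_neg (by simpa using h0)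
    have h2 := h0.unique (h1.congr
      ((L.eventually_notMem_lattice 0).mono fun x hx => (heven x hx).symm))
    linear_combination h2 / 2
  have hrem : ∀ a, HasSimplePole F a 0 := by
    intro a
    by_cases ha : a ∈ L.lattice
    · have h1 : HasSimplePole (fun x => F (x + -a)) a ρ :=
        HasSimplePole.comp_add (-a) (by simpa using h0)
      rw [hρ] at h1
      refine h1.congr ((L.eventually_notMem_lattice a).mono fun x hx => ?_)
      exact (hper _ (neg_mem ha) x hx).symm
    · exact HasSimplePole.of_analyticAt (hana a ha)
  obtain ⟨C, hC⟩ := L.exists_const_of_removable hrem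
    fun w hw a => (L.eventually_notMem_lattice a).mono (hper w hw)
  exact ⟨C, fun x hx => (hana x hx).continuousAt.eq_of_eventually_nhdsNE continuousAt_const (hC x)⟩

lemma weierstrassSigma_ne_zero {z : ℂ} (hz : z ∉ L.lattice) : L.weierstrassSigma z ≠ 0 :=
  mt L.weierstrassSigma_eq_zero_iff.1 hz

lemma neg_mem_lattice_iff {z : ℂ} : -z ∈ L.lattice ↔ z ∈ L.lattice := L.lattice.neg_mem_iff

lemma weierstrassP_add {w : ℂ} (hw : w ∈ L.lattice) (z : ℂ) :
    L.weierstrassP (z + w) = L.weierstrassP z := L.weierstrassP_add_coe z ⟨w, hw⟩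

/-- The quasi-periods of `ζ` are not proportional to the periods. Otherwise `ζ(x) - A x` would be
elliptic for some `A`; then `(ζ(x) - A x)² - ℘(x)` would be constant, and its values at
the half periods would show that `℘` takes the same value at all of them. This is the only
consequence of the Legendre relation that is needed. -/
lemma eq_of_zetaPeriod_eq_mul {A : ℂ} (hA : ∀ w ∈ L.lattice, L.zetaPeriod w = A * w) :
    L.weierstrassP (L.ω₁ / 2) = L.weierstrassP (L.ω₂ / 2) := by
  set f := fun x => L.weierstrassZeta x - A * x
  have hodd : ∀ x, f (-x) = -f x := fun x => by simp only [f, L.weierstrassZeta_neg]; ring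
  have hper : ∀ w ∈ L.lattice, ∀ x ∉ L.lattice, f (x + w) = f x := by
    intro w hw x hx
    simp only [f, L.weierstrassZeta_add hw hx, hA w hw]; ring
  have hfana : ∀ a ∉ L.lattice, AnalyticAt ℂ f a := fun a ha =>
    (L.analyticAt_weierstrassZeta ha).sub (by fun_prop)
  obtain ⟨h, hh, hf⟩ : HasSimplePole f 0 1 := by
    have := (L.hasSimplePole_weierstrassZeta 0).sub
      (HasSimplePole.of_analyticAt (f := fun x => A * x) (a := 0) (by fun_prop))
    rwa [if_pos (zero_mem _), sub_zero] at this
  obtain ⟨k, hk, hPk⟩ := L.exists_weierstrassP_eq (zero_mem L.lattice)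
  obtain ⟨C, hC⟩ := exists_const_of_even (L := L) (F := fun x => f x ^ 2 - L.weierstrassP x)
    (fun a ha => ((hfana a ha).pow 2).sub (L.analyticOnNhd_weierstrassP a ha))
    (fun w hw x hx => by rw [hper w hw x hx, L.weierstrassP_add hw])
    (fun x _ => by rw [hodd, L.weierstrassP_neg]; ring)
    (HasSimplePole.of_eq_div (m := fun x => 2 * h x + x * (h x ^ 2 - k x)) (by fun_prop) (by
      filter_upwards [hf, self_mem_nhdsWithin] with x hx hx0
      have hx0 : x ≠ 0 := hx0
      rw [hx, hPk]
      simp only [sub_zero]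
      field_simp
      ring))
  have hhalf : ∀ w ∈ L.lattice, w / 2 ∉ L.lattice → f (w / 2) = 0 := by
    intro w hw hw2
    have h1 := hper w hw (-(w / 2)) (by rwa [L.neg_mem_lattice_iff])
    rw [hodd, show -(w / 2) + w = w / 2 by ring] at h1
    linear_combination h1 / 2
  have h1 := hC _ L.ω₁_div_two_notMem_lattice
  have h2 := hC _ L.ω₂_div_two_notMem_lattice
  simp only [hhalf _ L.ω₁_mem_lattice L.ω₁_div_two_notMem_lattice,
    hhalf _ L.ω₂_mem_lattice L.ω₂_div_two_notMem_lattice] at h1 h2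
  linear_combination h2 - h1

/-- The addition formula `σ(x + y) σ(x - y) = -σ(x)² σ(y)² (℘(x) - ℘(y))`: as a function of `x`, the
quotient `σ(x + y) σ(x - y) / σ(x)² + σ(y)² ℘(x)` is even and elliptic, the double poles at the
periods cancel, and it vanishes at `y`. -/
theorem weierstrassSigma_add_mul_sub {x y : ℂ} (hx : x ∉ L.lattice) (hy : y ∉ L.lattice) :
    L.weierstrassSigma (x + y) * L.weierstrassSigma (x - y) =
      -(L.weierstrassSigma x ^ 2 * L.weierstrassSigma y ^ 2 *
        (L.weierstrassP x - L.weierstrassP y)) := by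
  have hσ : ∀ z, AnalyticAt ℂ L.weierstrassSigma z :=
    fun z => L.differentiable_weierstrassSigma.analyticAt z
  have hσ' : ∀ c z, AnalyticAt ℂ (fun x => L.weierstrassSigma (x + c)) z :=
    fun c z => (hσ (z + c)).comp_of_eq (by fun_prop) rfl
  obtain ⟨k, hk, hPk⟩ := L.exists_weierstrassP_eq (zero_mem L.lattice)
  set P := fun z => ∏' w : L.lattice, primaryFactor (z / w)
  have hP : AnalyticAt ℂ P 0 := L.differentiable_tprod_primaryFactor.analyticAt 0
  have hP1 : P 0 = 1 := by simp [P, primaryFactor_zero]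
  have hP0 : P 0 ≠ 0 := by simp [hP1]
  have hN : AnalyticAt ℂ (fun x =>
      L.weierstrassSigma (x + y) * L.weierstrassSigma (x + -y) / P x ^ 2 +
        L.weierstrassSigma y ^ 2 * (1 + x ^ 2 * k x)) 0 := by
    have h1 := hσ' y 0
    have h2 := hσ' (-y) 0
    exact ((h1.mul h2).div (hP.pow 2) (pow_ne_zero _ hP0)).add (by fun_prop)
  obtain ⟨M, hM, hNM⟩ := hN.exists_eq_add_sub_mul
  obtain ⟨C, hC⟩ := exists_const_of_even (L := L)
    (F := fun x => L.weierstrassSigma (x + y) * L.weierstrassSigma (x + -y) /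
      L.weierstrassSigma x ^ 2 + L.weierstrassSigma y ^ 2 * L.weierstrassP x)
    (fun a ha => (((hσ' y a).mul (hσ' (-y) a)).div ((hσ a).pow 2)
      (pow_ne_zero _ (L.weierstrassSigma_ne_zero ha))).add
      (analyticAt_const.mul (L.analyticOnNhd_weierstrassP a ha)))
    (fun w hw x hx => by
      obtain ⟨c, hc, hcσ⟩ := L.exists_weierstrassSigma_add hw
      have h1 := L.weierstrassSigma_ne_zero hx
      have h2 := Complex.exp_ne_zero (L.zetaPeriod w * x)
      have h3 : Complex.exp (L.zetaPeriod w * (x + y)) * Complex.exp (L.zetaPeriod w * (x + -y)) =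
          Complex.exp (L.zetaPeriod w * x) ^ 2 := by
        rw [sq, ← Complex.exp_add, ← Complex.exp_add]; ring_nf
      rw [add_right_comm, add_right_comm x w, hcσ, hcσ, hcσ, L.weierstrassP_add hw]
      congr 1
      field_simp
      linear_combination L.weierstrassSigma (x + y) * L.weierstrassSigma (x + -y) * h3)
    (fun x _ => by
      rw [L.weierstrassP_neg, L.weierstrassSigma_neg, show -x + y = -(x + -y) by ring,
        show -x + -y = -(x + y) by ring, L.weierstrassSigma_neg, L.weierstrassSigma_neg]
      ring)
    (HasSimplePole.of_eq_div hM (by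
      filter_upwards [nhdsWithin_le_nhds (hP.continuousAt.eventually_ne hP0), self_mem_nhdsWithin]
        with x hx hx0
      have hx0 : x ≠ 0 := hx0
      have h1 := hNM x
      simp only [hP1, zero_add, L.weierstrassSigma_neg, sub_zero] at h1
      rw [hPk, sub_zero, L.weierstrassSigma_eq x]
      change _ / (x * P x) ^ 2 + _ = _
      field_simp at h1 ⊢
      linear_combination h1))
  have h1 := hC x hx
  have h2 := hC y hy
  have hx0 := L.weierstrassSigma_ne_zero hx
  have h3 : L.weierstrassSigma 0 = 0 := L.weierstrassSigma_eq_zero_iff.2 (zero_mem _)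
  simp only [add_neg_cancel, h3, mul_zero, zero_div, zero_add] at h2
  rw [← h2, ← sub_eq_add_neg] at h1
  field_simp at h1
  linear_combination h1

/-- `℘` takes each value at most at one pair `±x` modulo periods. -/
lemma weierstrassP_eq_iff {x y : ℂ} (hx : x ∉ L.lattice) (hy : y ∉ L.lattice) :
    L.weierstrassP x = L.weierstrassP y ↔ x + y ∈ L.lattice ∨ x - y ∈ L.lattice := by
  have h := L.weierstrassSigma_add_mul_sub hx hy
  have hx0 := L.weierstrassSigma_ne_zero hx
  have hy0 := L.weierstrassSigma_ne_zero hy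
  rw [← L.weierstrassSigma_eq_zero_iff, ← L.weierstrassSigma_eq_zero_iff (z := x - y),
    ← mul_eq_zero, h, neg_eq_zero, mul_eq_zero, sub_eq_zero, or_iff_right (by positivity)]

lemma hasDerivAt_weierstrassP {x : ℂ} (hx : x ∉ L.lattice) :
    HasDerivAt L.weierstrassP (L.derivWeierstrassP x) x := by
  rw [← L.deriv_weierstrassP]
  exact (L.analyticOnNhd_weierstrassP x hx).differentiableAt.hasDerivAt

/-- The logarithmic derivative of `℘ - ℘(y)`. -/
lemma derivWeierstrassP_div_sub {x y : ℂ} (hx : x ∉ L.lattice) (hy : y ∉ L.lattice)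
    (h1 : x + y ∉ L.lattice) (h2 : x - y ∉ L.lattice) :
    L.derivWeierstrassP x / (L.weierstrassP x - L.weierstrassP y) =
      L.weierstrassZeta (x - y) + L.weierstrassZeta (x + y) - 2 * L.weierstrassZeta x := by
  have hσ := fun z => (L.differentiable_weierstrassSigma z).hasDerivAt
  have hP := L.hasDerivAt_weierstrassP hx
  have e1 := ((hσ (x + y)).comp_add_const x y).fun_mul ((hσ (x - y)).comp_sub_const x y)
  have e2 := (((((hσ x).fun_pow 2).mul_const (L.weierstrassSigma y ^ 2)).fun_mul
    (hP.sub_const (L.weierstrassP y)))).fun_neg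
  have e := e1.unique (e2.congr_of_eventuallyEq (by
    filter_upwards [L.isOpen_compl_lattice.mem_nhds hx] with z hz
      using L.weierstrassSigma_add_mul_sub hz hy))
  have n1 := L.weierstrassSigma_ne_zero hx
  have n2 := L.weierstrassSigma_ne_zero hy
  have n3 := L.weierstrassSigma_ne_zero h1
  have n4 := L.weierstrassSigma_ne_zero h2
  have n5 : L.weierstrassP x - L.weierstrassP y ≠ 0 := by
    rw [sub_ne_zero, Ne, L.weierstrassP_eq_iff hx hy]; tauto
  have h := L.weierstrassSigma_add_mul_sub hx hy
  have e3 : L.weierstrassZeta (x - y) + L.weierstrassZeta (x + y) =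
      (deriv L.weierstrassSigma (x + y) * L.weierstrassSigma (x - y) +
        L.weierstrassSigma (x + y) * deriv L.weierstrassSigma (x - y)) /
      (L.weierstrassSigma (x + y) * L.weierstrassSigma (x - y)) := by
    simp only [weierstrassZeta]
    field_simp
    ring
  rw [e3, e, h, weierstrassZeta]
  field_simp
  ring

lemma deriv_weierstrassSigma_zero : deriv L.weierstrassSigma 0 = 1 := by
  rw [funext L.weierstrassSigma_eq]
  have := (hasDerivAt_id (0 : ℂ)).fun_mul (L.differentiable_tprod_primaryFactor 0).hasDerivAt
  simp only [id] at this
  rw [this.deriv]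
  simp [primaryFactor_zero]

/-- The zeros of `℘'` are half-periods: this is the derivative in `x` of the addition formula at
`y = x`, where `σ'(0) = 1`. -/
lemma derivWeierstrassP_ne_zero {x : ℂ} (hx : 2 * x ∉ L.lattice) : L.derivWeierstrassP x ≠ 0 := by
  have hxL : x ∉ L.lattice := fun h => hx (by simpa [two_mul] using add_mem h h)
  intro h0
  have hσ := fun z => (L.differentiable_weierstrassSigma z).hasDerivAt
  have hP := L.hasDerivAt_weierstrassP hxL
  have e1 := ((hσ (x + x)).comp_add_const x x).fun_mul ((hσ (x - x)).comp_sub_const x x)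
  have e2 := (((((hσ x).fun_pow 2).mul_const (L.weierstrassSigma x ^ 2)).fun_mul
    (hP.sub_const (L.weierstrassP x)))).fun_neg
  have e := e1.unique (e2.congr_of_eventuallyEq (by
    filter_upwards [L.isOpen_compl_lattice.mem_nhds hxL] with z hz
      using L.weierstrassSigma_add_mul_sub hz hxL))
  have h3 : L.weierstrassSigma 0 = 0 := L.weierstrassSigma_eq_zero_iff.2 (zero_mem _)
  simp only [sub_self, h3, h0, L.deriv_weierstrassSigma_zero, mul_zero, zero_add, mul_one, add_zero,
    neg_zero] at e
  exact L.weierstrassSigma_ne_zero hx (by rw [two_mul, e])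

end PeriodPair

/-! ### Points modulo periods and half-periods -/

namespace PeriodPair

variable (L : PeriodPair)

open Classical in
/-- A periodic multiplicity function with discrete support is the counting function of finitely many
points modulo periods, listed with multiplicity. -/
lemma exists_points_of_multiplicity {n : ℂ → ℕ} (hper : ∀ w ∈ L.lattice, ∀ x, n (x + w) = n x)
    (hdisc : ∀ a, ∀ᶠ x in 𝓝[≠] a, n x = 0) :
    ∃ (N : ℕ) (t : Fin N → ℂ), ∀ a, n a = ∑ j, if a - t j ∈ L.lattice then 1 else 0 := by
  have hmem : ∀ x, x - ZSpan.fract L.basis x ∈ L.lattice := fun x => by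
    rw [ZSpan.fract, sub_sub_cancel, L.lattice_eq_span_range_basis]
    exact (ZSpan.floor L.basis x).2
  set S := {a ∈ ZSpan.fundamentalDomain L.basis | n a ≠ 0}
  have hS : S.Finite := by
    by_contra hinf
    obtain ⟨R, hR⟩ := (ZSpan.fundamentalDomain_isBounded L.basis).subset_closedBall 0
    obtain ⟨x, -, hx⟩ := Set.Infinite.exists_accPt_of_subset_isCompact hinf
      (isCompact_closedBall (0 : ℂ) R) fun a ha => hR ha.1
    rw [accPt_iff_frequently_nhdsNE] at hx
    exact hx ((hdisc x).mono fun y hy hyS => hyS.2 hy)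
  have : Fintype S := hS.fintype
  let e := Fintype.equivFin (Σ a : S, Fin (n a))
  refine ⟨_, fun j => (e.symm j).1, fun a => ?_⟩
  rw [Equiv.sum_comp e.symm (fun q : Σ a : S, Fin (n a) =>
      if a - (q.1 : ℂ) ∈ L.lattice then 1 else 0), Fintype.sum_sigma]
  have hinner : ∀ b : S, (∑ _y : Fin (n b), if a - (b : ℂ) ∈ L.lattice then 1 else 0) =
      if a - (b : ℂ) ∈ L.lattice then n b else 0 := fun b => by split_ifs <;> simp
  rw [Finset.sum_congr rfl fun b _ => hinner b]
  have hrep : n (ZSpan.fract L.basis a) = n a := by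
    rw [← hper _ (hmem a), add_sub_cancel]
  have huniq : ∀ b ∈ ZSpan.fundamentalDomain L.basis, a - b ∈ L.lattice →
      b = ZSpan.fract L.basis a := by
    intro b hb hab
    rw [← (ZSpan.fract_eq_self).2 hb, ZSpan.fract_eq_fract, neg_add_eq_sub,
      ← L.lattice_eq_span_range_basis]
    exact hab
  by_cases ha : n a = 0
  · rw [ha, Finset.sum_eq_zero]
    intro b _
    split_ifs with hab
    · rw [huniq b b.2.1 hab, hrep, ha]
    · rfl
  · rw [Finset.sum_eq_single ⟨ZSpan.fract L.basis a, ZSpan.fract_mem_fundamentalDomain _ _,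
      by rwa [hrep]⟩]
    · simp only [hmem, if_true, hrep]
    · intro b _ hb
      refine if_neg fun hab => hb (Subtype.ext (huniq b b.2.1 hab))
    · simp

lemma two_mul_halfPeriod_mem (i : Fin 4) : 2 * L.halfPeriod i ∈ L.lattice := by
  fin_cases i
  · simp [halfPeriod]
  · simpa [halfPeriod, mul_div_cancel₀] using L.ω₁_mem_lattice
  · have := sub_mem (neg_mem L.ω₁_mem_lattice) L.ω₂_mem_lattice
    simp only [halfPeriod]
    convert this using 1
    simp
    ring
  · simpa [halfPeriod, mul_div_cancel₀] using L.ω₂_mem_lattice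

/-- Every half of a period is congruent to one of the four half-periods. -/
lemma exists_add_halfPeriod_mem {x : ℂ} (hx : 2 * x ∈ L.lattice) :
    ∃ i, x + L.halfPeriod i ∈ L.lattice := by
  obtain ⟨m, n, h⟩ := mem_lattice.1 hx
  have key : ∀ (i : Fin 4) (p q : ℤ), x + L.halfPeriod i = p * L.ω₁ + q * L.ω₂ →
    ∃ i, x + L.halfPeriod i ∈ L.lattice := fun i p q h => ⟨i, mem_lattice.2 ⟨p, q, h.symm⟩⟩
  rcases Int.even_or_odd' m with ⟨p, rfl | rfl⟩ <;>
    rcases Int.even_or_odd' n with ⟨q, rfl | rfl⟩ <;> push_cast at h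
  · exact key 0 p q (by simp [halfPeriod]; linear_combination -h / 2)
  · exact key 3 p (q + 1) (by simp [halfPeriod]; linear_combination -h / 2)
  · exact key 1 (p + 1) q (by simp [halfPeriod]; linear_combination -h / 2)
  · exact key 2 p q (by simp [halfPeriod]; linear_combination -h / 2)

lemma halfPeriod_sub_mem_iff {i j : Fin 4} :
    L.halfPeriod i - L.halfPeriod j ∈ L.lattice ↔ i = j := by
  refine ⟨fun h => ?_, fun h => by simp [h]⟩
  have key : ∀ i, L.halfPeriod i = ((![0, 1 / 2, -1 / 2, 0] : Fin 4 → ℚ) i : ℂ) * L.ω₁ +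
      ((![0, 0, -1 / 2, 1 / 2] : Fin 4 → ℚ) i : ℂ) * L.ω₂ := by
    intro i
    fin_cases i <;> simp [halfPeriod] <;> ring
  have e : L.halfPeriod i - L.halfPeriod j =
      (((![0, 1 / 2, -1 / 2, 0] : Fin 4 → ℚ) i - (![0, 1 / 2, -1 / 2, 0] : Fin 4 → ℚ) j : ℚ) : ℂ)
        * L.ω₁ +
      (((![0, 0, -1 / 2, 1 / 2] : Fin 4 → ℚ) i - (![0, 0, -1 / 2, 1 / 2] : Fin 4 → ℚ) j : ℚ) : ℂ)
        * L.ω₂ := by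
    rw [key i, key j]; push_cast; ring
  rw [e, mul_ω₁_add_mul_ω₂_mem_lattice] at h
  revert h
  fin_cases i <;> fin_cases j <;> norm_num

lemma halfPeriod_mem_iff {i : Fin 4} : L.halfPeriod i ∈ L.lattice ↔ i = 0 := by
  rw [← L.halfPeriod_sub_mem_iff (j := 0)]
  simp [halfPeriod]

/-- The quasi-periods of `ζ` are not proportional to the periods. -/
lemma not_exists_zetaPeriod_eq_mul : ¬ ∃ A : ℂ, ∀ w ∈ L.lattice, L.zetaPeriod w = A * w := by
  rintro ⟨A, hA⟩
  have h1 := L.halfPeriod_sub_mem_iff (i := 1) (j := 3)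
  have h2 := L.eq_of_zetaPeriod_eq_mul hA
  rw [L.weierstrassP_eq_iff L.ω₁_div_two_notMem_lattice L.ω₂_div_two_notMem_lattice] at h2
  have h3 := L.add_mem_lattice_iff L.ω₂_mem_lattice (x := L.ω₁ / 2 - L.ω₂ / 2)
  rw [show L.ω₁ / 2 - L.ω₂ / 2 + L.ω₂ = L.ω₁ / 2 + L.ω₂ / 2 by ring] at h3
  rw [h3, or_self] at h2
  exact absurd (h1.1 (by simpa [halfPeriod] using h2)) (by decide)

end PeriodPair

/-! ### Singular points and the leading behaviour of the potential -/

open Classical in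
/-- Each pole of `1 / (℘ - ℘(δ))` is at most simple when `δ` is not a half-period: the residues of
its logarithmic derivative, a sum of zeta functions, are at least `-1`. -/
lemma PeriodPair.tendsto_sq_div_weierstrassP_sub (L : PeriodPair) {δ : ℂ} (hδ : 2 * δ ∉ L.lattice)
    (a : ℂ) : Tendsto (fun x => (x - a) ^ 2 * (1 / (L.weierstrassP x - L.weierstrassP δ)))
      (𝓝[≠] a) (𝓝 0) := by
  have hδL : δ ∉ L.lattice := fun h => hδ (by simpa [two_mul] using add_mem h h)
  have hgen : ∀ᶠ x in 𝓝[≠] a, x ∉ L.lattice ∧ x + δ ∉ L.lattice ∧ x - δ ∉ L.lattice ∧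
      L.weierstrassP x - L.weierstrassP δ ≠ 0 := by
    filter_upwards [L.eventually_notMem_lattice a, L.eventually_sub_notMem_lattice a δ,
      L.eventually_sub_notMem_lattice a (-δ)] with x h1 h2 h3
    rw [sub_neg_eq_add] at h3
    refine ⟨h1, h3, h2, ?_⟩
    rw [sub_ne_zero, Ne, L.weierstrassP_eq_iff h1 hδL]
    tauto
  have hmer : MeromorphicAt (fun x => 1 / (L.weierstrassP x - L.weierstrassP δ)) a := by
    have := L.meromorphic_weierstrassP a
    fun_prop
  have hH := (((L.hasSimplePole_weierstrassZeta_sub δ a).add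
    (L.hasSimplePole_weierstrassZeta_sub (-δ) a)).sub
      ((L.hasSimplePole_weierstrassZeta a).const_mul 2)).neg
  obtain ⟨n, hn, g, hg, -, hφ⟩ := exists_eq_zpow_mul_of_logDeriv hmer
    ((meromorphicOrderAt_ne_top_iff_eventually_ne_zero hmer).2 (hgen.mono fun x hx => by
      simpa using hx.2.2.2)) hH (by
    filter_upwards [hgen] with x ⟨h1, h2, h3, h4⟩
    have := ((L.hasDerivAt_weierstrassP h1).sub_const (L.weierstrassP δ)).fun_inv h4
    simp only [← one_div] at this
    rw [this.deriv, sub_neg_eq_add, ← L.derivWeierstrassP_div_sub h1 hδL h2 h3]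
    field_simp)
  have hn2 : ∃ m : ℕ, n + 2 = m + 1 := by
    rw [sub_neg_eq_add] at hn
    have : -1 ≤ n := by
      split_ifs at hn with h1 h2 h3 h2 h3 h3 <;> norm_num at hn <;> norm_cast at hn <;>
        first | omega | skip
      all_goals exact absurd (by simpa [two_mul] using sub_mem h2 h1) hδ
    exact ⟨(n + 1).toNat, by omega⟩
  obtain ⟨m, hm⟩ := hn2
  have hc : ContinuousAt (fun x => (x - a) ^ (m + 1) * g x) a := by
    have := hg.continuousAt
    fun_prop
  have h0 := hc.tendsto.mono_left (nhdsWithin_le_nhds (s := {a}ᶜ))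
  simp only [sub_self, ne_eq, Nat.add_eq_zero_iff, one_ne_zero, and_false, not_false_eq_true,
    zero_pow, zero_mul] at h0
  refine h0.congr' ?_
  filter_upwards [hφ, self_mem_nhdsWithin] with x hx hxa
  have hxa : x - a ≠ 0 := sub_ne_zero.2 hxa
  rw [hx, ← mul_assoc, ← zpow_natCast, ← zpow_natCast, ← zpow_add₀ hxa]
  congr 2
  push_cast
  omega

namespace EllipticData

variable (D : EllipticData)

/-- Representatives `-ωᵢ`, `δ`, `-δ` of the singular points modulo periods. -/
noncomputable def singPt : Fin 4 ⊕ Fin D.M ⊕ Fin D.M → ℂ :=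
  Sum.elim (fun i => -D.L.halfPeriod i) (Sum.elim D.δ fun i => -D.δ i)

/-- The numbers `2 lᵢ` and `r` attached to the singular points; the exponents of
`f'' = (v - E) f` at a singular point with weight `m` are `-m / 2` and `m / 2 + 1`. -/
def singWeight : Fin 4 ⊕ Fin D.M ⊕ Fin D.M → ℕ := Sum.elim (fun i => 2 * D.l i) (Sum.elim D.r D.r)

open Classical in
/-- The weight of an arbitrary point: the exponents of `f'' = (v - E) f` at `a` are
`-D.weight a / 2` and `D.weight a / 2 + 1`. It vanishes at regular points. -/
noncomputable def weight (a : ℂ) : ℕ :=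
  ∑ k, if a - D.singPt k ∈ D.L.lattice then D.singWeight k else 0

lemma mem_sing_iff {a : ℂ} : a ∈ D.sing ↔ ∃ k, a - D.singPt k ∈ D.L.lattice := by
  simp only [sing, Set.mem_ofPred_eq, singPt, Sum.exists, Sum.elim_inl, Sum.elim_inr,
    sub_neg_eq_add, exists_or]
  refine or_congr ⟨D.L.exists_add_halfPeriod_mem, fun ⟨i, hi⟩ => ?_⟩ Iff.rfl
  have := sub_mem (add_mem hi hi) (D.L.two_mul_halfPeriod_mem i)
  rwa [show a + D.L.halfPeriod i + (a + D.L.halfPeriod i) - 2 * D.L.halfPeriod i = 2 * a by ring]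
    at this

lemma isClosed_sing : IsClosed D.sing := by
  have : D.sing = ⋃ k, (fun x => x - D.singPt k) ⁻¹' D.L.lattice := by
    ext x; simp [D.mem_sing_iff]
  rw [this]
  exact isClosed_iUnion_of_finite fun k => D.L.isClosed_lattice.preimage (by fun_prop)

lemma isPreconnected_compl_sing : IsPreconnected D.singᶜ := by
  refine (Set.Countable.isConnected_compl_of_one_lt_rank (by simp) ?_).2
  have : D.sing = ⋃ k, (fun x => x - D.singPt k) ⁻¹' D.L.lattice := by
    ext x; simp [D.mem_sing_iff]
  rw [this]
  exact Set.countable_iUnion fun k =>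
    Set.Countable.preimage_of_injOn (s := (D.L.lattice : Set ℂ))
      (countable_of_Lindelof_of_discrete (X := D.L.lattice)) sub_left_injective.injOn

lemma eventually_notMem_sing (a : ℂ) : ∀ᶠ x in 𝓝[≠] a, x ∉ D.sing := by
  simp only [D.mem_sing_iff, not_exists, eventually_all]
  exact fun k => D.L.eventually_sub_notMem_lattice a _

variable {D}

lemma sing_neg_iff {x : ℂ} : -x ∈ D.sing ↔ x ∈ D.sing := by
  have key : ∀ x ∈ D.sing, -x ∈ D.sing := by
    rintro x (h | ⟨i, h | h⟩)
    · exact Or.inl (by simpa using h)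
    · exact Or.inr ⟨i, Or.inr (by simpa [neg_add_eq_sub] using neg_mem h)⟩
    · exact Or.inr ⟨i, Or.inl (by simpa [sub_eq_add_neg, add_comm] using neg_mem h)⟩
  exact ⟨fun h => by simpa using key _ h, key x⟩

lemma notMem_lattice {x : ℂ} (hx : x ∉ D.sing) : x ∉ D.L.lattice := fun h =>
  hx (Or.inl (by simpa [two_mul] using add_mem h h))

lemma notMem_lattice_of_two_mul {x : ℂ} (hx : 2 * x ∉ D.L.lattice) : x ∉ D.L.lattice := fun h =>
  hx (by simpa [two_mul] using add_mem h h)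

section

variable (hδ : ∀ i, 2 * D.δ i ∉ D.L.lattice) (hb : Function.Injective D.b)
include hδ

lemma weierstrassP_ne_b {x : ℂ} (hx : x ∉ D.sing) (i : Fin D.M) : D.L.weierstrassP x ≠ D.b i := by
  rw [b, Ne, D.L.weierstrassP_eq_iff (notMem_lattice hx) (notMem_lattice_of_two_mul (hδ i))]
  exact fun h => hx (Or.inr ⟨i, h.symm⟩)

lemma analyticAt_v {x : ℂ} (hx : x ∉ D.sing) : AnalyticAt ℂ D.v x := by
  have hk := fun k => mt (fun h => D.mem_sing_iff.2 ⟨k, h⟩) hx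
  have hP : ∀ p, x + p ∉ D.L.lattice → AnalyticAt ℂ (fun x => D.L.weierstrassP (x + p)) x :=
    fun p hp => (D.L.analyticOnNhd_weierstrassP _ hp).comp_of_eq (by fun_prop) rfl
  have h0 := D.L.analyticOnNhd_weierstrassP x (notMem_lattice hx)
  have h1 : ∀ i : Fin 4, AnalyticAt ℂ (fun x => D.L.weierstrassP (x + D.L.halfPeriod i)) x :=
    fun i => hP _ (by simpa [singPt] using hk (Sum.inl i))
  have h2 : ∀ i, AnalyticAt ℂ (fun x => D.L.weierstrassP (x + D.δ i)) x :=
    fun i => hP _ (by simpa [singPt] using hk (Sum.inr (Sum.inr i)))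
  have h3 : ∀ i, AnalyticAt ℂ (fun x => D.L.weierstrassP (x - D.δ i)) x :=
    fun i => by
      have := hP (-D.δ i) (by simpa [singPt, ← sub_eq_add_neg] using hk (Sum.inr (Sum.inl i)))
      simpa only [← sub_eq_add_neg] using this
  unfold v
  refine AnalyticAt.fun_add (Finset.analyticAt_fun_sum _ fun i _ => analyticAt_const.mul (h1 i))
    (Finset.analyticAt_fun_sum _ fun i _ =>
      AnalyticAt.fun_add (analyticAt_const.mul ((h3 i).add (h2 i)))
        (analyticAt_const.div (h0.sub analyticAt_const)
        (sub_ne_zero.2 (weierstrassP_ne_b hδ hx i))))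

include hb

/-- The singular points `-ωᵢ`, `δ`, `-δ` are pairwise incongruent. -/
lemma singPt_injective {a : ℂ} {k k' : Fin 4 ⊕ Fin D.M ⊕ Fin D.M}
    (hk : a - D.singPt k ∈ D.L.lattice) (hk' : a - D.singPt k' ∈ D.L.lattice) : k = k' := by
  have h := sub_mem hk hk'
  rw [sub_sub_sub_cancel_left] at h
  have hhalf : ∀ i j, D.L.halfPeriod i + D.δ j ∉ D.L.lattice := by
    intro i j h
    have := sub_mem (add_mem h h) (D.L.two_mul_halfPeriod_mem i)
    exact hδ j (by convert this using 1; ring)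
  have hhalf' : ∀ i j, D.L.halfPeriod i - D.δ j ∉ D.L.lattice := by
    intro i j h
    have := sub_mem (D.L.two_mul_halfPeriod_mem i) (add_mem h h)
    exact hδ j (by convert this using 1; ring)
  have hPδ : ∀ i j, (D.δ i + D.δ j ∈ D.L.lattice ∨ D.δ i - D.δ j ∈ D.L.lattice) → i = j :=
    fun i j h => hb ((D.L.weierstrassP_eq_iff (notMem_lattice_of_two_mul (hδ i))
      (notMem_lattice_of_two_mul (hδ j))).2 h)
  have hsum : ∀ i j, D.δ i + D.δ j ∉ D.L.lattice := by
    intro i j h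
    obtain rfl := hPδ i j (Or.inl h)
    exact hδ i (by rwa [two_mul])
  have hn : ∀ {x : ℂ}, x ∈ D.L.lattice → -x ∈ D.L.lattice := fun h => neg_mem h
  rcases k with i | i | i <;> rcases k' with j | j | j <;>
    simp only [singPt, Sum.elim_inl, Sum.elim_inr] at h
  · rw [(D.L.halfPeriod_sub_mem_iff (i := i) (j := j)).1 (by convert h using 1; ring)]
  · exact absurd (by convert h using 1; ring) (hhalf i j)
  · exact absurd (by convert h using 1; ring) (hhalf' i j)
  · exact absurd (by convert hn h using 1; ring) (hhalf j i)
  · rw [hPδ i j (Or.inr (by convert hn h using 1; ring))]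
  · exact absurd (by convert hn h using 1; ring) (hsum i j)
  · exact absurd (by convert hn h using 1; ring) (hhalf' j i)
  · exact absurd (by convert h using 1; ring) (hsum i j)
  · rw [hPδ i j (Or.inr (by convert h using 1; ring))]

open Classical in
lemma sum_ite_singPt {R : Type*} [AddCommMonoid R] {a : ℂ} {k : Fin 4 ⊕ Fin D.M ⊕ Fin D.M}
    (hk : a - D.singPt k ∈ D.L.lattice) (F : Fin 4 ⊕ Fin D.M ⊕ Fin D.M → R) :
    (∑ k, if a - D.singPt k ∈ D.L.lattice then F k else 0) = F k := by
  rw [Finset.sum_eq_single k, if_pos hk]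
  · exact fun k' _ hkk' => if_neg fun h => hkk' (singPt_injective hδ hb h hk)
  · simp

lemma weight_eq {a : ℂ} {k : Fin 4 ⊕ Fin D.M ⊕ Fin D.M} (hk : a - D.singPt k ∈ D.L.lattice) :
    D.weight a = D.singWeight k :=
  sum_ite_singPt hδ hb hk D.singWeight

lemma weight_eq_r {a : ℂ} {i : Fin D.M}
    (h : a - D.δ i ∈ D.L.lattice ∨ a + D.δ i ∈ D.L.lattice) : D.weight a = D.r i := by
  rcases h with h | h
  · exact weight_eq hδ hb (k := Sum.inr (Sum.inl i)) h
  · exact weight_eq hδ hb (k := Sum.inr (Sum.inr i)) (by simpa [singPt] using h)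

lemma weight_eq_l {a : ℂ} {i : Fin 4} (h : a + D.L.halfPeriod i ∈ D.L.lattice) :
    D.weight a = 2 * D.l i :=
  weight_eq hδ hb (k := Sum.inl i) (by simpa [singPt] using h)

end

lemma weight_eq_zero {a : ℂ} (ha : a ∉ D.sing) : D.weight a = 0 := by
  simp only [D.mem_sing_iff, not_exists] at ha
  simp [weight, ha]

lemma weight_add {w : ℂ} (hw : w ∈ D.L.lattice) (a : ℂ) : D.weight (a + w) = D.weight a := by
  classical
  refine Finset.sum_congr rfl fun k _ => if_congr ?_ rfl rfl
  rw [add_sub_right_comm, D.L.add_mem_lattice_iff hw]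

lemma weight_neg (hδ : ∀ i, 2 * D.δ i ∉ D.L.lattice) (hb : Function.Injective D.b) (a : ℂ) :
    D.weight (-a) = D.weight a := by
  by_cases ha : a ∈ D.sing
  · rcases ha with h | ⟨i, h⟩
    · obtain ⟨i, hi⟩ := D.L.exists_add_halfPeriod_mem h
      rw [weight_eq_l hδ hb hi, weight_eq_l hδ hb (i := i)]
      have := sub_mem (D.L.two_mul_halfPeriod_mem i) hi
      convert this using 1
      ring
    · rw [weight_eq_r hδ hb h, weight_eq_r hδ hb (i := i)]
      rw [← D.L.neg_mem_lattice_iff, ← D.L.neg_mem_lattice_iff (z := -a + _)]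
      simpa [or_comm, add_comm, sub_eq_add_neg] using h
  · rw [weight_eq_zero ha, weight_eq_zero (mt sing_neg_iff.1 ha)]

open Classical in
/-- The leading coefficient of the potential at each of its poles. -/
lemma tendsto_sq_mul_v (hδ : ∀ i, 2 * D.δ i ∉ D.L.lattice) (hb : Function.Injective D.b) (a : ℂ) :
    Tendsto (fun x => (x - a) ^ 2 * D.v x) (𝓝[≠] a)
      (𝓝 ((D.weight a : ℂ) / 2 * ((D.weight a : ℂ) / 2 + 1))) := by
  have hv : ∀ x, (x - a) ^ 2 * D.v x =
      ∑ k, ((D.singWeight k : ℂ) / 2 * ((D.singWeight k : ℂ) / 2 + 1)) *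
        ((x - a) ^ 2 * D.L.weierstrassP (x - D.singPt k)) +
      ∑ i, D.s i * ((x - a) ^ 2 * (1 / (D.L.weierstrassP x - D.L.weierstrassP (D.δ i)))) := by
    intro x
    simp only [v, singWeight, singPt, b, Fintype.sum_sum_type, Sum.elim_inl, Sum.elim_inr,
      sub_neg_eq_add]
    rw [mul_add, Finset.mul_sum, Finset.mul_sum, add_assoc, ← Finset.sum_add_distrib,
      ← Finset.sum_add_distrib]
    congr 1 <;> refine Finset.sum_congr rfl fun i _ => ?_
    · push_cast; ring
    · ring
  have h1 : ((D.weight a : ℂ) / 2 * ((D.weight a : ℂ) / 2 + 1)) =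
      ∑ k, ((D.singWeight k : ℂ) / 2 * ((D.singWeight k : ℂ) / 2 + 1)) *
        (if a - D.singPt k ∈ D.L.lattice then 1 else 0) + ∑ i, D.s i * 0 := by
    simp only [mul_ite, mul_one, mul_zero, Finset.sum_const_zero, add_zero]
    by_cases ha : a ∈ D.sing
    · obtain ⟨k, hk⟩ := D.mem_sing_iff.1 ha
      rw [sum_ite_singPt hδ hb hk, weight_eq hδ hb hk]
    · rw [weight_eq_zero ha]
      simp only [D.mem_sing_iff, not_exists] at ha
      simp [ha]
  rw [h1]
  refine Tendsto.congr (fun x => (hv x).symm) (Tendsto.add ?_ ?_)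
  · exact tendsto_finsetSum _ fun k _ => (D.L.tendsto_sq_mul_weierstrassP _ a).const_mul _
  · exact tendsto_finsetSum _ fun i _ => (D.L.tendsto_sq_div_weierstrassP_sub (hδ i) a).const_mul _

end EllipticData

/-! ### The logarithmic derivative of `Λ` -/

namespace EllipticData

variable {D : EllipticData} {Ξ : ℂ → ℂ} {κ : ℂ}

/-- `Ξ` is a nonzero even elliptic solution of the third order equation (normalised to vanish on the
singular set), with `κ² = -Q ≠ 0`. Constancy of `Q` replaces the differential equation itself. -/
structure IsProductSolution (D : EllipticData) (Ξ : ℂ → ℂ) (κ : ℂ) : Prop where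
  meromorphicAt : ∀ x, MeromorphicAt Ξ x
  even : ∀ x, Ξ (-x) = Ξ x
  periodic : ∀ w ∈ D.L.lattice, ∀ x, Ξ (x + w) = Ξ x
  eq_zero : ∀ x ∈ D.sing, Ξ x = 0
  analyticAt : ∀ x ∉ D.sing, AnalyticAt ℂ Ξ x
  eventually_ne_zero : ∀ a, ∀ᶠ x in 𝓝[≠] a, Ξ x ≠ 0
  ne_zero : κ ≠ 0
  sq_eq : ∀ x ∉ D.sing, κ ^ 2 = -D.Q Ξ x

/-- The quantity `Q` is constant off the singular set, since its derivative is `Ξ / 2` times the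
left-hand side of the third order equation. -/
lemma Q_eq_of_mem (hδ : ∀ i, 2 * D.δ i ∉ D.L.lattice) (hΞ : Ξ ∈ D.evenPeriodicSolutions)
    {x y : ℂ} (hx : x ∉ D.sing) (hy : y ∉ D.sing) : D.Q Ξ x = D.Q Ξ y := by
  have hd : ∀ x ∉ D.sing, HasDerivAt (D.Q Ξ) 0 x := by
    intro x hx
    obtain ⟨hA, hode⟩ := hΞ.2.2.2.2.2 x hx
    have h0 := hA.differentiableAt.hasDerivAt
    have h1 := hA.deriv.differentiableAt.hasDerivAt
    have h2 := hA.deriv.deriv.differentiableAt.hasDerivAt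
    have hv := (analyticAt_v hδ hx).differentiableAt.hasDerivAt
    have := (((h0.fun_pow 2).fun_mul (hv.const_sub D.E)).fun_add
      ((h0.const_mul (1 / 2)).fun_mul h2)).fun_sub ((h1.fun_pow 2).const_mul (1 / 4))
    refine this.congr_deriv ?_
    simp only [iteratedDeriv_succ, iteratedDeriv_zero] at hode
    push_cast
    linear_combination Ξ x / 2 * hode
  exact D.isClosed_sing.isOpen_compl.is_const_of_deriv_eq_zero D.isPreconnected_compl_sing
    (fun x hx => (hd x hx).differentiableAt.differentiableWithinAt) (fun x hx => (hd x hx).deriv)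
    hx hy

lemma isProductSolution_of_mem (hδ : ∀ i, 2 * D.δ i ∉ D.L.lattice)
    (hΞ : Ξ ∈ D.evenPeriodicSolutions) (hΞ0 : Ξ ≠ 0) {x₀ : ℂ} (hx₀ : x₀ ∉ D.sing)
    (hQ : D.Q Ξ x₀ ≠ 0) (hκ : κ ^ 2 = -D.Q Ξ x₀) : D.IsProductSolution Ξ κ := by
  obtain ⟨hmer, heven, h1, h2, hsing, hana⟩ := id hΞ
  refine ⟨hmer, heven, fun w hw x => ?_, hsing, fun x hx => (hana x hx).1, ?_, ?_, fun x hx => ?_⟩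
  · obtain ⟨m, n, rfl⟩ := PeriodPair.mem_lattice.1 hw
    have e1 : Function.Periodic Ξ D.L.ω₁ := h1
    have e2 : Function.Periodic Ξ D.L.ω₂ := h2
    rw [← add_assoc, (e2.int_mul n) _, (e1.int_mul m) _]
  · suffices h : ∀ u, meromorphicOrderAt Ξ u ≠ ⊤ from fun a =>
      (meromorphicOrderAt_ne_top_iff_eventually_ne_zero (hmer a)).1 (h a)
    rw [← Meromorphic.exists_meromorphicOrderAt_ne_top_iff_forall hmer]
    by_contra! hall
    refine hΞ0 (funext fun x => ?_)
    by_cases hx : x ∈ D.sing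
    · exact hsing x hx
    · exact (hana x hx).1.continuousAt.eq_of_eventually_nhdsNE (g := fun _ => 0) continuousAt_const
        (meromorphicOrderAt_eq_top_iff.1 (hall x))
  · rintro rfl
    exact hQ (by linear_combination hκ)
  · rw [hκ, Q_eq_of_mem hδ hΞ hx hx₀]

/-- The logarithmic derivative of `√Ξ exp ∫ κ dx / Ξ`. -/
noncomputable def lamLogDeriv (Ξ : ℂ → ℂ) (κ x : ℂ) : ℂ := (deriv Ξ x + 2 * κ) / (2 * Ξ x)

namespace IsProductSolution

lemma lamLogDeriv_neg (H : D.IsProductSolution Ξ κ) (x : ℂ) :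
    lamLogDeriv Ξ κ (-x) = -lamLogDeriv Ξ (-κ) x := by
  have h : deriv Ξ (-x) = -deriv Ξ x := by
    have := deriv_comp_neg Ξ x
    rw [funext H.even] at this
    rw [this, neg_neg]
  rw [lamLogDeriv, lamLogDeriv, h, H.even, ← neg_div]
  ring

lemma lamLogDeriv_add (H : D.IsProductSolution Ξ κ) {w : ℂ} (hw : w ∈ D.L.lattice) (x : ℂ) :
    lamLogDeriv Ξ κ (x + w) = lamLogDeriv Ξ κ x := by
  have h : deriv Ξ (x + w) = deriv Ξ x := by
    rw [← deriv_comp_add_const, funext (H.periodic w hw)]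
  rw [lamLogDeriv, lamLogDeriv, h, H.periodic w hw]

lemma analyticAt_lamLogDeriv (H : D.IsProductSolution Ξ κ) {x : ℂ} (hx : x ∉ D.sing)
    (hΞx : Ξ x ≠ 0) : AnalyticAt ℂ (lamLogDeriv Ξ κ) x :=
  ((H.analyticAt x hx).deriv.add analyticAt_const).div (analyticAt_const.mul (H.analyticAt x hx))
    (mul_ne_zero two_ne_zero hΞx)

/-- The Riccati equation for the logarithmic derivative, equivalent to `Λ'' = (v - E) Λ`. -/
lemma deriv_lamLogDeriv_add_sq (H : D.IsProductSolution Ξ κ) {x : ℂ} (hx : x ∉ D.sing)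
    (hΞx : Ξ x ≠ 0) :
    deriv (lamLogDeriv Ξ κ) x + lamLogDeriv Ξ κ x ^ 2 = D.v x - D.E := by
  have hA := H.analyticAt x hx
  have h0 := hA.differentiableAt.hasDerivAt
  have h1 := hA.deriv.differentiableAt.hasDerivAt
  have := (h1.add_const (2 * κ)).fun_div (h0.const_mul 2) (mul_ne_zero two_ne_zero hΞx)
  have hd : deriv (lamLogDeriv Ξ κ) x = _ := this.deriv
  have hs := H.sq_eq x hx
  rw [hd, lamLogDeriv]
  simp only [Q] at hs
  field_simp
  linear_combination 4 * hs

/-- The residue of the logarithmic derivative of `Λ` is one of the two exponents. -/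
lemma exists_residue (H : D.IsProductSolution Ξ κ) (hδ : ∀ i, 2 * D.δ i ∉ D.L.lattice)
    (hb : Function.Injective D.b) (a : ℂ) :
    ∃ n : ℕ, (n = 0 ∨ n = D.weight a + 1) ∧
      HasSimplePole (lamLogDeriv Ξ κ) a (n - (D.weight a : ℂ) / 2) := by
  have hmer : MeromorphicAt (lamLogDeriv Ξ κ) a :=
    ((H.meromorphicAt a).deriv.add (MeromorphicAt.const _ a)).div
      ((MeromorphicAt.const _ a).mul (H.meromorphicAt a))
  have hu : Tendsto (fun x => (x - a) ^ 2 * (D.v x - D.E)) (𝓝[≠] a)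
      (𝓝 ((D.weight a : ℂ) / 2 * ((D.weight a : ℂ) / 2 + 1))) := by
    have hc : ContinuousAt (fun x => (x - a) ^ 2 * D.E) a := by fun_prop
    have h1 := hc.tendsto.mono_left (nhdsWithin_le_nhds (s := {a}ᶜ))
    have h2 := (tendsto_sq_mul_v hδ hb a).sub h1
    simp only [sub_self, ne_eq, OfNat.ofNat_ne_zero, not_false_eq_true, zero_pow, zero_mul,
      sub_zero] at h2
    refine h2.congr fun x => by ring
  obtain ⟨ρ, hρ, hρ2⟩ := exists_hasSimplePole_of_riccati hmer (by
    filter_upwards [D.eventually_notMem_sing a, H.eventually_ne_zero a] with x h1 h2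
      using H.deriv_lamLogDeriv_add_sq h1 h2) hu
  have : (ρ + (D.weight a : ℂ) / 2) * (ρ - ((D.weight a : ℂ) / 2 + 1)) = 0 := by
    linear_combination hρ2
  rcases mul_eq_zero.1 this with h | h
  · refine ⟨0, Or.inl rfl, ?_⟩
    rwa [show ((0 : ℕ) : ℂ) - (D.weight a : ℂ) / 2 = ρ by push_cast; linear_combination -h]
  · refine ⟨D.weight a + 1, Or.inr rfl, ?_⟩
    rwa [show ((D.weight a + 1 : ℕ) : ℂ) - (D.weight a : ℂ) / 2 = ρ by
      push_cast; linear_combination -h]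

lemma hasSimplePole_neg (H : D.IsProductSolution Ξ κ) {a ρ : ℂ}
    (h : HasSimplePole (lamLogDeriv Ξ κ) (-a) ρ) : HasSimplePole (lamLogDeriv Ξ (-κ)) a ρ := by
  refine (neg_neg ρ ▸ h.comp_neg.neg).congr (Eventually.of_forall fun x => ?_)
  rw [H.lamLogDeriv_neg, neg_neg]

/-- The order of `Ξ = Λ(x) Λ(-x)` is the sum of the residues of the logarithmic derivatives. -/
lemma exists_eq_zpow_mul (H : D.IsProductSolution Ξ κ) {a ρ ρ' : ℂ}
    (h : HasSimplePole (lamLogDeriv Ξ κ) a ρ) (h' : HasSimplePole (lamLogDeriv Ξ κ) (-a) ρ') :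
    ∃ n : ℤ, (n : ℂ) = ρ + ρ' ∧ ∃ g : ℂ → ℂ, AnalyticAt ℂ g a ∧ g a ≠ 0 ∧
      ∀ᶠ x in 𝓝[≠] a, Ξ x = (x - a) ^ n * g x := by
  refine exists_eq_zpow_mul_of_logDeriv (H.meromorphicAt a)
    ((meromorphicOrderAt_ne_top_iff_eventually_ne_zero (H.meromorphicAt a)).2
      (H.eventually_ne_zero a)) (h.add (H.hasSimplePole_neg h')) ?_
  filter_upwards [H.eventually_ne_zero a] with x hx
  simp only [lamLogDeriv]
  field_simp
  ring

lemma eventually_mul_sub (H : D.IsProductSolution Ξ κ) (a : ℂ) :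
    ∀ᶠ x in 𝓝[≠] a, Ξ x * (lamLogDeriv Ξ κ x - lamLogDeriv Ξ (-κ) x) = 2 * κ := by
  filter_upwards [H.eventually_ne_zero a] with x hx
  simp only [lamLogDeriv]
  field_simp
  ring

/-- The larger exponent cannot occur at both `a` and `-a`: there `Ξ` would vanish while `2 κ / Ξ`,
the difference of two logarithmic derivatives with the same residue, would be regular. -/
lemma not_upper_of_upper (H : D.IsProductSolution Ξ κ) {a : ℂ} {m : ℕ}
    (h : HasSimplePole (lamLogDeriv Ξ κ) a ((m : ℂ) / 2 + 1))
    (h' : HasSimplePole (lamLogDeriv Ξ κ) (-a) ((m : ℂ) / 2 + 1)) : False := by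
  obtain ⟨n, hn, g, hg, -, hΞ⟩ := H.exists_eq_zpow_mul h h'
  have hn : n = (m + 1 : ℕ) + 1 := by
    have : (n : ℂ) = ((m + 1 : ℕ) + 1 : ℤ) := by push_cast; linear_combination hn
    exact_mod_cast this
  subst hn
  obtain ⟨k, hk, hdiff⟩ := h.sub (H.hasSimplePole_neg h')
  have hc : ContinuousAt (fun x => (x - a) ^ (m + 2) * g x * k x) a := by
    have h1 := hg.continuousAt
    have h2 := hk.continuousAt
    fun_prop
  have h0 := ContinuousAt.eq_of_eventually_nhdsNE hc (continuousAt_const (y := 2 * κ)) (by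
    filter_upwards [hΞ, hdiff, H.eventually_mul_sub a] with x h1 h2 h3
    rw [h1, h2, sub_self, zero_div, zero_add] at h3
    exact_mod_cast h3)
  simp only [sub_self, ne_eq, Nat.add_eq_zero_iff, OfNat.ofNat_ne_zero, and_false,
    not_false_eq_true, zero_pow, zero_mul] at h0
  exact H.ne_zero (by linear_combination -h0 / 2)

end IsProductSolution

/-- The part of the logarithmic derivative of `1 / Λ` that comes from the denominator of the
Bethe-Ansatz expression: it has residue half the weight at each point. -/
noncomputable def singLog (D : EllipticData) (x : ℂ) : ℂ :=
  ∑ i : Fin 4, (D.l i : ℂ) *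
    (D.L.weierstrassZeta (x + D.L.halfPeriod i) - D.L.weierstrassZeta (D.L.halfPeriod i)) +
  ∑ i, (D.r i : ℂ) / 2 * (D.L.weierstrassZeta (x - D.δ i) + D.L.weierstrassZeta (x + D.δ i))

/-- The logarithmic derivative of the Bethe-Ansatz expression. -/
noncomputable def betheLog (D : EllipticData) {N : ℕ} (t : Fin N → ℂ) (c x : ℂ) : ℂ :=
  c + ∑ j, D.L.weierstrassZeta (x - t j) - D.singLog x

/-- The number of points `t j` congruent to `a`. -/
noncomputable def count (D : EllipticData) {N : ℕ} (t : Fin N → ℂ) (a : ℂ) : ℕ :=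
  {j | a - t j ∈ D.L.lattice}.ncard

open Classical in
lemma count_eq_sum {N : ℕ} (t : Fin N → ℂ) (a : ℂ) :
    D.count t a = ∑ j, if a - t j ∈ D.L.lattice then 1 else 0 := by
  rw [count, Set.ncard_eq_toFinset_card', Finset.sum_boole]
  simp

lemma count_pos (t : Fin D.N → ℂ) {a : ℂ} {j : Fin D.N} (h : a - t j ∈ D.L.lattice) :
    0 < D.count t a := (Set.ncard_pos (Set.toFinite _)).2 ⟨j, h⟩

lemma hasSimplePole_singLog (a : ℂ) : HasSimplePole D.singLog a ((D.weight a : ℂ) / 2) := by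
  classical
  have hz : ∀ p, HasSimplePole (fun x => D.L.weierstrassZeta (x + p)) a
      (if a - -p ∈ D.L.lattice then 1 else 0) := fun p => by
    simpa only [sub_neg_eq_add] using D.L.hasSimplePole_weierstrassZeta_sub (-p) a
  have h := (HasSimplePole.sum Finset.univ fun i (_ : i ∈ Finset.univ) =>
    (((hz (D.L.halfPeriod i)).sub
      (HasSimplePole.const (D.L.weierstrassZeta (D.L.halfPeriod i)))).const_mul (D.l i : ℂ))).add
    (HasSimplePole.sum Finset.univ fun i (_ : i ∈ Finset.univ) =>
      ((D.L.hasSimplePole_weierstrassZeta_sub (D.δ i) a).add (hz (D.δ i))).const_mul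
        ((D.r i : ℂ) / 2))
  have e : (D.weight a : ℂ) / 2 = ∑ k, (D.singWeight k : ℂ) / 2 *
      (if a - D.singPt k ∈ D.L.lattice then 1 else 0) := by
    rw [weight, Nat.cast_sum, Finset.sum_div]
    refine Finset.sum_congr rfl fun k _ => ?_
    split_ifs <;> simp
  rw [e, Fintype.sum_sum_type, Fintype.sum_sum_type, ← Finset.sum_add_distrib]
  have h' : HasSimplePole D.singLog a _ := h
  convert h' using 1
  refine congrArg₂ (fun x y : ℂ => x + y) (Finset.sum_congr rfl fun i _ => ?_)
    (Finset.sum_congr rfl fun i _ => ?_)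
  · change ((2 * D.l i : ℕ) : ℂ) / 2 * (if a - -D.L.halfPeriod i ∈ D.L.lattice then 1 else 0) = _
    push_cast
    ring
  · change (D.r i : ℂ) / 2 * (if a - D.δ i ∈ D.L.lattice then 1 else 0) +
      (D.r i : ℂ) / 2 * (if a - -D.δ i ∈ D.L.lattice then 1 else 0) = _
    ring

lemma hasSimplePole_betheLog {N : ℕ} (t : Fin N → ℂ) (c a : ℂ) :
    HasSimplePole (D.betheLog t c) a (D.count t a - (D.weight a : ℂ) / 2) := by
  classical
  have h := ((HasSimplePole.const c).add (HasSimplePole.sum Finset.univ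
    fun j (_ : j ∈ Finset.univ) => D.L.hasSimplePole_weierstrassZeta_sub (t j) a)).sub
      (D.hasSimplePole_singLog a)
  rw [zero_add] at h
  rw [count_eq_sum]
  push_cast
  exact h

lemma notMem_lattice_of_notMem_sing {x : ℂ} (hx : x ∉ D.sing) :
    (∀ i, x + D.L.halfPeriod i ∉ D.L.lattice) ∧ (∀ i, x - D.δ i ∉ D.L.lattice) ∧
      ∀ i, x + D.δ i ∉ D.L.lattice := by
  have hk := fun k => mt (fun h => D.mem_sing_iff.2 ⟨k, h⟩) hx
  exact ⟨fun i => by simpa [singPt] using hk (Sum.inl i),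
    fun i => by simpa [singPt] using hk (Sum.inr (Sum.inl i)),
    fun i => by simpa [singPt] using hk (Sum.inr (Sum.inr i))⟩

lemma singLog_add {w : ℂ} (hw : w ∈ D.L.lattice) {x : ℂ} (hx : x ∉ D.sing) :
    D.singLog (x + w) = D.singLog x + D.N * D.L.zetaPeriod w := by
  obtain ⟨h1, h2, h3⟩ := notMem_lattice_of_notMem_sing hx
  have e1 := fun i => D.L.weierstrassZeta_add hw (h1 i)
  have e2 := fun i => D.L.weierstrassZeta_add hw (h2 i)
  have e3 := fun i => D.L.weierstrassZeta_add hw (h3 i)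
  simp only [singLog, add_right_comm x w, add_sub_right_comm x w, e1, e2, e3, N]
  push_cast
  rw [add_mul, Finset.sum_mul, Finset.sum_mul, add_add_add_comm, ← Finset.sum_add_distrib,
    ← Finset.sum_add_distrib]
  congr 1 <;> exact Finset.sum_congr rfl fun i _ => by ring

lemma singLog_neg {x : ℂ} (hx : x ∉ D.sing) : D.singLog (-x) = -D.singLog x := by
  obtain ⟨h1, h2, h3⟩ := notMem_lattice_of_notMem_sing hx
  rw [singLog, singLog, neg_add, ← Finset.sum_neg_distrib, ← Finset.sum_neg_distrib]
  congr 1 <;> refine Finset.sum_congr rfl fun i _ => ?_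
  · have h := D.L.weierstrassZeta_add_sub (D.L.halfPeriod i) (D.L.two_mul_halfPeriod_mem i)
      (fun h => by rw [D.L.halfPeriod_mem_iff.1 h]; rfl) (h1 i)
    rw [h, show -x + D.L.halfPeriod i = -(x - D.L.halfPeriod i) by ring, D.L.weierstrassZeta_neg]
    ring
  · rw [show -x - D.δ i = -(x + D.δ i) by ring, show -x + D.δ i = -(x - D.δ i) by ring,
      D.L.weierstrassZeta_neg, D.L.weierstrassZeta_neg]
    ring

/-- The logarithmic derivative of `Λ` has Bethe-Ansatz form. After subtraction of zeta functions
that match its poles, Liouville's theorem leaves an affine function; the quasi-periods of `ζ` are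
not proportional to the periods, so the number of zeros must be `D.N` and the function is constant. -/
theorem IsProductSolution.exists_betheLog (H : D.IsProductSolution Ξ κ)
    (hδ : ∀ i, 2 * D.δ i ∉ D.L.lattice) (hb : Function.Injective D.b) :
    ∃ (t : Fin D.N → ℂ) (c : ℂ), ∀ a, ∀ᶠ x in 𝓝[≠] a, lamLogDeriv Ξ κ x = D.betheLog t c x := by
  choose n _ hn using H.exists_residue hδ hb
  have hnper : ∀ w ∈ D.L.lattice, ∀ a, n (a + w) = n a := by
    intro w hw a
    have h1 := ((hn (a + w)).comp_add w).congr (g := lamLogDeriv Ξ κ)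
      (Eventually.of_forall fun x => (H.lamLogDeriv_add hw x).symm)
    have h2 := h1.unique (hn a)
    rw [weight_add hw] at h2
    exact_mod_cast sub_left_injective h2
  have hndisc : ∀ a, ∀ᶠ x in 𝓝[≠] a, n x = 0 := by
    intro a
    filter_upwards [(hn a).eventually_removable, D.eventually_notMem_sing a] with x hx hxs
    have := (hn x).unique hx
    rw [weight_eq_zero hxs] at this
    simpa using this
  obtain ⟨N, t, ht⟩ := D.L.exists_points_of_multiplicity hnper hndisc
  obtain ⟨A, B, hA, hB⟩ := D.L.exists_affine_of_removable
    (f := fun x => lamLogDeriv Ξ κ x - D.betheLog t 0 x)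
    (k := fun w => ((D.N : ℂ) - N) * D.L.zetaPeriod w) (fun a => by
      have := (hn a).sub (D.hasSimplePole_betheLog t 0 a)
      rwa [ht a, ← count_eq_sum, sub_self] at this)
    (fun w hw a => by
      filter_upwards [D.eventually_notMem_sing a,
        eventually_all.2 fun j => D.L.eventually_sub_notMem_lattice a (t j)] with x h1 h2
      have e := fun j => D.L.weierstrassZeta_add hw (h2 j)
      simp only [H.lamLogDeriv_add hw, betheLog, singLog_add hw h1, add_sub_right_comm x w, e,
        Finset.sum_add_distrib, Finset.sum_const, Finset.card_univ, Fintype.card_fin, nsmul_eq_mul]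
      ring)
  have hNN : N = D.N := by
    by_contra hne
    have hne' : (D.N : ℂ) - N ≠ 0 := sub_ne_zero.2 (by exact_mod_cast Ne.symm hne)
    refine D.L.not_exists_zetaPeriod_eq_mul ⟨A / (D.N - N), fun w hw => ?_⟩
    have := hA w hw
    field_simp
    linear_combination this
  subst hNN
  have hA0 : A = 0 := by
    have := hA _ D.L.ω₁_mem_lattice
    have hne : D.L.ω₁ ≠ 0 := by simpa using D.L.indep.ne_zero 0
    simpa [hne, eq_comm] using this
  refine ⟨t, B, fun a => ?_⟩
  filter_upwards [hB a] with x hx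
  rw [hA0] at hx
  simp only [betheLog] at hx ⊢
  linear_combination hx

end EllipticData

/-! ### Branches and their logarithmic derivatives -/

/-- `f` is differentiable and nonzero at `x`, with logarithmic derivative `d`. -/
def HasLogDerivAt (f : ℂ → ℂ) (d x : ℂ) : Prop := f x ≠ 0 ∧ HasDerivAt f (f x * d) x

namespace HasLogDerivAt

variable {f g : ℂ → ℂ} {a b x : ℂ}

lemma mul (hf : HasLogDerivAt f a x) (hg : HasLogDerivAt g b x) :
    HasLogDerivAt (fun x => f x * g x) (a + b) x :=
  ⟨mul_ne_zero hf.1 hg.1, (hf.2.fun_mul hg.2).congr_deriv (by ring)⟩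

lemma inv (hf : HasLogDerivAt f a x) : HasLogDerivAt (fun x => (f x)⁻¹) (-a) x := by
  refine ⟨inv_ne_zero hf.1, (hf.2.fun_inv hf.1).congr_deriv ?_⟩
  have := hf.1
  field_simp

lemma div (hf : HasLogDerivAt f a x) (hg : HasLogDerivAt g b x) :
    HasLogDerivAt (fun x => f x / g x) (a - b) x := by
  simpa only [div_eq_mul_inv, sub_eq_add_neg] using hf.mul hg.inv

lemma const {c : ℂ} (hc : c ≠ 0) : HasLogDerivAt (fun _ => c) 0 x :=
  ⟨hc, by simpa using hasDerivAt_const x c⟩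

lemma pow (hf : HasLogDerivAt f a x) (n : ℕ) : HasLogDerivAt (fun x => f x ^ n) (n * a) x := by
  induction n with
  | zero => simpa using const (x := x) one_ne_zero
  | succ n ih =>
    simp only [pow_succ]
    convert ih.mul hf using 1
    push_cast
    ring

lemma prod {ι : Type*} {s : Finset ι} {F : ι → ℂ → ℂ} {A : ι → ℂ}
    (h : ∀ i ∈ s, HasLogDerivAt (F i) (A i) x) :
    HasLogDerivAt (fun x => ∏ i ∈ s, F i x) (∑ i ∈ s, A i) x := by
  classical
  induction s using Finset.induction_on with
  | empty => simpa using const (x := x) one_ne_zero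
  | insert i s hi ih =>
    simp only [Finset.prod_insert hi, Finset.sum_insert hi]
    exact (h i (by simp)).mul (ih fun j hj => h j (by simp [hj]))

lemma cexp (h : HasDerivAt f a x) : HasLogDerivAt (fun x => Complex.exp (f x)) a x :=
  ⟨Complex.exp_ne_zero _, h.cexp⟩

lemma congr (hf : HasLogDerivAt f a x) (h : ∀ᶠ y in 𝓝 x, g y = f y) : HasLogDerivAt g a x :=
  ⟨h.self_of_nhds ▸ hf.1, h.self_of_nhds ▸ hf.2.congr_of_eventuallyEq h⟩

lemma congr_val (hf : HasLogDerivAt f a x) (h : a = b) : HasLogDerivAt f b x := h ▸ hf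

lemma of_sq (hf : DifferentiableAt ℂ f x) (h : HasLogDerivAt (fun x => f x ^ 2) (2 * a) x) :
    HasLogDerivAt f a x := by
  have h0 : f x ≠ 0 := fun h0 => h.1 (by simp [h0])
  refine ⟨h0, hf.hasDerivAt.congr_deriv ?_⟩
  have := (hf.hasDerivAt.fun_pow 2).unique h.2
  refine mul_left_cancel₀ (mul_ne_zero two_ne_zero h0) ?_
  push_cast at this
  linear_combination this

lemma unique (h : HasLogDerivAt f a x) (h' : HasLogDerivAt f b x) : a = b :=
  mul_left_cancel₀ h.1 (h.2.unique h'.2)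

/-- Two functions with the same logarithmic derivative on a domain are proportional. -/
lemma exists_eq_const_mul {U : Set ℂ} (hU : IsOpen U) (hU' : IsConnected U) {d : ℂ → ℂ}
    (hf : ∀ x ∈ U, HasLogDerivAt f (d x) x) (hg : ∀ x ∈ U, HasLogDerivAt g (d x) x) :
    ∃ C : ℂ, C ≠ 0 ∧ ∀ x ∈ U, f x = C * g x := by
  have h : ∀ x ∈ U, HasDerivAt (fun x => f x / g x) 0 x := fun x hx => by
    simpa using ((hf x hx).div (hg x hx)).2
  obtain ⟨x₀, hx₀⟩ := hU'.nonempty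
  refine ⟨f x₀ / g x₀, div_ne_zero (hf x₀ hx₀).1 (hg x₀ hx₀).1, fun x hx => ?_⟩
  have := hU.is_const_of_deriv_eq_zero hU'.isPreconnected
    (fun x hx => (h x hx).differentiableAt.differentiableWithinAt) (fun x hx => (h x hx).deriv)
    hx hx₀
  rw [← this, div_mul_cancel₀ _ (hg x hx).1]

end HasLogDerivAt

lemma PeriodPair.hasLogDerivAt_weierstrassSigma (L : PeriodPair) {p x : ℂ} (h : x + p ∉ L.lattice) :
    HasLogDerivAt (fun x => L.weierstrassSigma (x + p)) (L.weierstrassZeta (x + p)) x := by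
  have h0 := L.weierstrassSigma_ne_zero h
  refine ⟨h0, HasDerivAt.congr_deriv
    ((L.differentiable_weierstrassSigma (x + p)).hasDerivAt.comp_add_const x p) ?_⟩
  rw [weierstrassZeta]
  field_simp

lemma PeriodPair.hasLogDerivAt_coSigma (L : PeriodPair) {i : Fin 4} (hi : i ≠ 0) {x : ℂ}
    (h : x + L.halfPeriod i ∉ L.lattice) :
    HasLogDerivAt (L.coSigma i)
      (L.weierstrassZeta (x + L.halfPeriod i) - L.weierstrassZeta (L.halfPeriod i)) x := by
  have h1 : HasDerivAt (fun x => -(L.weierstrassZeta (L.halfPeriod i)) * x)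
      (-(L.weierstrassZeta (L.halfPeriod i))) x := by
    simpa using (hasDerivAt_id x).const_mul (-(L.weierstrassZeta (L.halfPeriod i)))
  have h2 := ((HasLogDerivAt.cexp h1).mul (L.hasLogDerivAt_weierstrassSigma h)).div
    (HasLogDerivAt.const (L.weierstrassSigma_ne_zero (mt L.halfPeriod_mem_iff.1 hi)))
  exact h2.congr_val (by ring)

namespace EllipticData

variable {D : EllipticData} {Ξ : ℂ → ℂ} {κ : ℂ} {U : Set ℂ} {Λ Ψ : ℂ → ℂ}

lemma IsLambdaBranch.hasLogDerivAt (hΛ : IsLambdaBranch Ξ κ U Λ) {x : ℂ} (hx : x ∈ U)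
    (hΞx : Ξ x ≠ 0) : HasLogDerivAt Λ (lamLogDeriv Ξ κ x) x := by
  obtain ⟨R, I, hR, h⟩ := hΛ x hx
  have hsq : ∀ᶠ y in 𝓝 x, R y ^ 2 = Ξ y := h.mono fun y hy => hy.1
  have hR0 : R x ≠ 0 := fun h0 => hΞx (by rw [← hsq.self_of_nhds, h0]; simp)
  have h1 : deriv Ξ x = 2 * R x * deriv R x := by
    rw [← Filter.EventuallyEq.deriv_eq hsq, (hR.differentiableAt.hasDerivAt.fun_pow 2).deriv]
    simp
  have h2 : HasLogDerivAt R (deriv R x / R x) x :=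
    ⟨hR0, hR.differentiableAt.hasDerivAt.congr_deriv (by field_simp)⟩
  convert (h2.mul (HasLogDerivAt.cexp h.self_of_nhds.2.1)).congr (h.mono fun y hy => hy.2.2) using 1
  rw [lamLogDeriv, h1, ← hsq.self_of_nhds]
  field_simp

lemma IsPsiBranch.hasLogDerivAt (hδ : ∀ i, 2 * D.δ i ∉ D.L.lattice) (hU : IsOpen U)
    (hΨ : D.IsPsiBranch U Ψ) {x : ℂ} (hx : x ∈ U) (hxs : x ∉ D.sing) :
    HasLogDerivAt Ψ (∑ i, (D.r i : ℂ) / 2 * (D.L.weierstrassZeta (x - D.δ i) +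
      D.L.weierstrassZeta (x + D.δ i) - 2 * D.L.weierstrassZeta x)) x := by
  refine HasLogDerivAt.of_sq (hΨ.1 x hx).differentiableAt ?_
  obtain ⟨-, h2, h3⟩ := notMem_lattice_of_notMem_sing hxs
  have hP : ∀ i, HasLogDerivAt (fun x => D.L.weierstrassP x - D.b i)
      (D.L.weierstrassZeta (x - D.δ i) + D.L.weierstrassZeta (x + D.δ i) -
        2 * D.L.weierstrassZeta x) x := by
    intro i
    have h0 := sub_ne_zero.2 (weierstrassP_ne_b hδ hxs i)
    refine ⟨h0, ((D.L.hasDerivAt_weierstrassP (notMem_lattice hxs)).sub_const _).congr_deriv ?_⟩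
    rw [← D.L.derivWeierstrassP_div_sub (notMem_lattice hxs) (notMem_lattice_of_two_mul (hδ i))
      (h3 i) (h2 i), ← b, mul_div_cancel₀ _ h0]
  convert (HasLogDerivAt.prod (s := Finset.univ) fun i _ => (hP i).pow (D.r i)).congr
    (g := fun x => Ψ x ^ 2) (by filter_upwards [hU.mem_nhds hx] with y hy using hΨ.2 y hy) using 1
  rw [Finset.mul_sum]
  exact Finset.sum_congr rfl fun i _ => by ring

lemma analyticAt_betheLog {N : ℕ} {t : Fin N → ℂ} (c : ℂ) {x : ℂ} (hxs : x ∉ D.sing)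
    (ht : ∀ j, x - t j ∉ D.L.lattice) : AnalyticAt ℂ (D.betheLog t c) x := by
  obtain ⟨h1, h2, h3⟩ := notMem_lattice_of_notMem_sing hxs
  have hz : ∀ p, x + p ∉ D.L.lattice → AnalyticAt ℂ (fun x => D.L.weierstrassZeta (x + p)) x :=
    fun p hp => (D.L.analyticAt_weierstrassZeta hp).comp_of_eq (by fun_prop) rfl
  have hz' : ∀ p, x - p ∉ D.L.lattice → AnalyticAt ℂ (fun x => D.L.weierstrassZeta (x - p)) x :=
    fun p hp => by
      have := hz (-p) (by rwa [← sub_eq_add_neg])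
      simpa only [← sub_eq_add_neg] using this
  exact (analyticAt_const.add (Finset.analyticAt_fun_sum _ fun j _ => hz' _ (ht j))).sub
    ((Finset.analyticAt_fun_sum _ fun i _ =>
        analyticAt_const.mul ((hz _ (h1 i)).sub analyticAt_const)).add
      (Finset.analyticAt_fun_sum _ fun i _ =>
        analyticAt_const.mul ((hz' _ (h2 i)).add (hz _ (h3 i)))))

/-- The Bethe-Ansatz expression without its constant factor. -/
noncomputable def betheFun (D : EllipticData) (Ψ : ℂ → ℂ) (t : Fin D.N → ℂ) (c x : ℂ) : ℂ :=
  (∏ j, D.L.weierstrassSigma (x - t j)) /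
    (Ψ x * D.L.weierstrassSigma x ^ D.lTilde 0 * D.L.coSigma 1 x ^ D.lTilde 1 *
      D.L.coSigma 2 x ^ D.lTilde 2 * D.L.coSigma 3 x ^ D.lTilde 3) * Complex.exp (c * x)

lemma isBetheForm_iff {t : Fin D.N → ℂ} {c C₀ : ℂ} :
    D.IsBetheForm U Λ Ψ t c C₀ ↔ C₀ ≠ 0 ∧ ∀ x ∈ U, Λ x = C₀ * D.betheFun Ψ t c x := by
  simp only [IsBetheForm, betheFun, mul_div_assoc, mul_assoc]

lemma hasLogDerivAt_betheFun (hδ : ∀ i, 2 * D.δ i ∉ D.L.lattice) (hU : IsOpen U)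
    (hΨ : D.IsPsiBranch U Ψ) {t : Fin D.N → ℂ} {c x : ℂ} (hx : x ∈ U) (hxs : x ∉ D.sing)
    (ht : ∀ j, x - t j ∉ D.L.lattice) :
    HasLogDerivAt (D.betheFun Ψ t c) (D.betheLog t c x) x := by
  obtain ⟨h1, -, -⟩ := notMem_lattice_of_notMem_sing hxs
  have hnum := HasLogDerivAt.prod (s := Finset.univ) (x := x)
    (F := fun j x => D.L.weierstrassSigma (x - t j)) (A := fun j => D.L.weierstrassZeta (x - t j))
    fun j _ => by
      simpa only [sub_eq_add_neg] using
        D.L.hasLogDerivAt_weierstrassSigma (p := -t j) (by simpa [← sub_eq_add_neg] using ht j)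
  have hσ : HasLogDerivAt D.L.weierstrassSigma (D.L.weierstrassZeta x) x := by
    simpa using D.L.hasLogDerivAt_weierstrassSigma (p := 0) (x := x)
      (by simpa using notMem_lattice hxs)
  have hco := fun (i : Fin 4) (hi : i ≠ 0) => (D.L.hasLogDerivAt_coSigma hi (h1 i)).pow (D.lTilde i)
  have hexp : HasDerivAt (fun x => c * x) c x := by simpa using (hasDerivAt_id x).const_mul c
  refine HasLogDerivAt.congr_val (f := D.betheFun Ψ t c)
    ((hnum.div (((((hΨ.hasLogDerivAt hδ hU hx hxs).mul (hσ.pow (D.lTilde 0))).mul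
    (hco 1 (by decide))).mul (hco 2 (by decide))).mul (hco 3 (by decide)))).mul
      (HasLogDerivAt.cexp hexp)) ?_
  have h0 : D.L.halfPeriod 0 = 0 := rfl
  simp only [betheLog, singLog, Fin.sum_univ_four, h0, add_zero,
    D.L.weierstrassZeta_of_mem (zero_mem _), sub_zero]
  have e : ∑ i, (D.r i : ℂ) / 2 * (D.L.weierstrassZeta (x - D.δ i) +
      D.L.weierstrassZeta (x + D.δ i) - 2 * D.L.weierstrassZeta x) =
      ∑ i, (D.r i : ℂ) / 2 * (D.L.weierstrassZeta (x - D.δ i) + D.L.weierstrassZeta (x + D.δ i)) -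
      (∑ i, (D.r i : ℂ)) * D.L.weierstrassZeta x := by
    rw [Finset.sum_mul, ← Finset.sum_sub_distrib]
    exact Finset.sum_congr rfl fun i _ => by ring
  rw [e]
  simp [lTilde]
  ring

namespace IsProductSolution

/-- Every branch of `Λ` is a multiple of the Bethe-Ansatz expression with the right logarithmic
derivative. -/
lemma exists_isBetheForm (H : D.IsProductSolution Ξ κ) (hδ : ∀ i, 2 * D.δ i ∉ D.L.lattice)
    {t : Fin D.N → ℂ} {c : ℂ}
    (ht : ∀ a, ∀ᶠ x in 𝓝[≠] a, lamLogDeriv Ξ κ x = D.betheLog t c x)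
    (hU : D.IsRegularDomain Ξ U) (hΛ : IsLambdaBranch Ξ κ U Λ) (hΨ : D.IsPsiBranch U Ψ) :
    ∃ C₀, D.IsBetheForm U Λ Ψ t c C₀ := by
  obtain ⟨hUo, hUc, hUr⟩ := hU
  have key : ∀ x ∈ U, (∀ j, x - t j ∉ D.L.lattice) ∧ lamLogDeriv Ξ κ x = D.betheLog t c x := by
    intro x hx
    obtain ⟨hxs, hΞx⟩ := hUr x hx
    have hA := H.analyticAt_lamLogDeriv hxs hΞx
    have h1 := (((D.hasSimplePole_betheLog t c x).congr (ht x)).unique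
      (HasSimplePole.of_analyticAt hA))
    rw [weight_eq_zero hxs] at h1
    have h2 : D.count t x = 0 := by simpa using h1
    have h3 : ∀ j, x - t j ∉ D.L.lattice := fun j hj => (count_pos t hj).ne' h2
    refine ⟨h3, hA.continuousAt.eq_of_eventually_nhdsNE ?_ (ht x)⟩
    exact (analyticAt_betheLog c hxs h3).continuousAt
  obtain ⟨C₀, hC₀, h⟩ := HasLogDerivAt.exists_eq_const_mul hUo hUc (f := Λ)
    (g := D.betheFun Ψ t c) (d := lamLogDeriv Ξ κ)
    (fun x hx => hΛ.hasLogDerivAt hx (hUr x hx).2) (fun x hx => by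
      rw [(key x hx).2]
      exact hasLogDerivAt_betheFun hδ hUo hΨ hx (hUr x hx).1 (key x hx).1)
  exact ⟨C₀, isBetheForm_iff.2 ⟨hC₀, h⟩⟩

/-- A Bethe-Ansatz expression for one branch of `Λ` determines its logarithmic derivative
globally. -/
lemma eventually_eq_betheLog (H : D.IsProductSolution Ξ κ) (hδ : ∀ i, 2 * D.δ i ∉ D.L.lattice)
    {t : Fin D.N → ℂ} {c C₀ : ℂ}
    (hU : D.IsRegularDomain Ξ U) (hΛ : IsLambdaBranch Ξ κ U Λ) (hΨ : D.IsPsiBranch U Ψ)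
    (hB : D.IsBetheForm U Λ Ψ t c C₀) (a : ℂ) :
    ∀ᶠ x in 𝓝[≠] a, lamLogDeriv Ξ κ x = D.betheLog t c x := by
  obtain ⟨hUo, hUc, hUr⟩ := hU
  obtain ⟨hC₀, hB⟩ := isBetheForm_iff.1 hB
  have key : ∀ x ∈ U, lamLogDeriv Ξ κ x = D.betheLog t c x := by
    intro x hx
    obtain ⟨hxs, hΞx⟩ := hUr x hx
    have h1 := hΛ.hasLogDerivAt hx hΞx
    have h3 : ∀ j, x - t j ∉ D.L.lattice := by
      intro j hj
      refine h1.1 ?_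
      rw [hB x hx, betheFun, Finset.prod_eq_zero (Finset.mem_univ j)
        (D.L.weierstrassSigma_eq_zero_iff.2 hj)]
      simp
    refine h1.unique ?_
    have h4 := (HasLogDerivAt.const hC₀).mul (hasLogDerivAt_betheFun (c := c) hδ hUo hΨ hx hxs h3)
    rw [zero_add] at h4
    exact h4.congr (by filter_upwards [hUo.mem_nhds hx] with y hy using hB y hy)
  have hmer : Meromorphic fun x => lamLogDeriv Ξ κ x - D.betheLog t c x := fun x =>
    (((H.meromorphicAt x).deriv.add (MeromorphicAt.const _ x)).div
      ((MeromorphicAt.const _ x).mul (H.meromorphicAt x))).sub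
        (D.hasSimplePole_betheLog t c x).meromorphicAt
  have hall : ¬ ∀ u, meromorphicOrderAt (fun x => lamLogDeriv Ξ κ x - D.betheLog t c x) u ≠ ⊤ := by
    intro h
    obtain ⟨x₀, hx₀⟩ := hUc.nonempty
    refine h x₀ (meromorphicOrderAt_eq_top_iff.2 ?_)
    filter_upwards [nhdsWithin_le_nhds (hUo.mem_nhds hx₀)] with y hy
    rw [key y hy, sub_self]
  rw [← Meromorphic.exists_meromorphicOrderAt_ne_top_iff_forall hmer] at hall
  push Not at hall
  filter_upwards [meromorphicOrderAt_eq_top_iff.1 (hall a)] with x hx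
  exact sub_eq_zero.1 hx

end IsProductSolution

end EllipticData

/-! ### `Ξ` at the zeros of `Λ` and at the origin -/

namespace EllipticData

variable {D : EllipticData} {Ξ : ℂ → ℂ} {κ : ℂ}

open Classical in
/-- The even elliptic function `Ξ` as a function of `z = ℘(x)`. -/
noncomputable def descend (D : EllipticData) (Ξ : ℂ → ℂ) (z : ℂ) : ℂ :=
  if h : ∃ x, x ∉ D.L.lattice ∧ D.L.weierstrassP x = z then Ξ h.choose else 0

namespace IsProductSolution

lemma descend_weierstrassP (H : D.IsProductSolution Ξ κ) {x : ℂ} (hx : x ∉ D.L.lattice) :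
    D.descend Ξ (D.L.weierstrassP x) = Ξ x := by
  have h : ∃ y, y ∉ D.L.lattice ∧ D.L.weierstrassP y = D.L.weierstrassP x := ⟨x, hx, rfl⟩
  rw [descend, dif_pos h]
  obtain ⟨h1, h2⟩ := h.choose_spec
  rcases (D.L.weierstrassP_eq_iff h1 hx).1 h2 with h3 | h3
  · rw [← H.even x, ← H.periodic _ h3 (-x)]
    ring_nf
  · rw [← H.periodic _ h3 x]
    ring_nf

/-- `dΞ/dz = Ξ' / ℘'` where `℘' ≠ 0`. -/
lemma hasDerivAt_descend (H : D.IsProductSolution Ξ κ) {a d : ℂ} (ha : 2 * a ∉ D.L.lattice)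
    (hd : HasDerivAt Ξ d a) :
    HasDerivAt (D.descend Ξ) (d / D.L.derivWeierstrassP a) (D.L.weierstrassP a) := by
  have haL := notMem_lattice_of_two_mul ha
  have hP0 := D.L.derivWeierstrassP_ne_zero ha
  have hP : HasStrictDerivAt D.L.weierstrassP (D.L.derivWeierstrassP a) a := by
    have := (D.L.analyticOnNhd_weierstrassP a haL).hasStrictDerivAt
    rwa [D.L.deriv_weierstrassP] at this
  set h := hP.localInverse D.L.weierstrassP (D.L.derivWeierstrassP a) a hP0
  have h1 : h (D.L.weierstrassP a) = a :=
    HasStrictFDerivAt.localInverse_apply_image (hP.hasStrictFDerivAt_equiv hP0)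
  have h2 : HasDerivAt h (D.L.derivWeierstrassP a)⁻¹ (D.L.weierstrassP a) :=
    (hP.to_localInverse hP0).hasDerivAt
  have h3 : ∀ᶠ w in 𝓝 (D.L.weierstrassP a), D.L.weierstrassP (h w) = w :=
    HasStrictFDerivAt.eventually_right_inverse (hP.hasStrictFDerivAt_equiv hP0)
  have h4 : ∀ᶠ w in 𝓝 (D.L.weierstrassP a), h w ∉ D.L.lattice := by
    have hc := h2.continuousAt.tendsto
    rw [h1] at hc
    exact hc.eventually (D.L.isOpen_compl_lattice.mem_nhds haL)
  have h5 : HasDerivAt (fun w => Ξ (h w)) (d * (D.L.derivWeierstrassP a)⁻¹) (D.L.weierstrassP a) :=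
    HasDerivAt.comp (h₂ := Ξ) _ (by rwa [h1]) h2
  rw [div_eq_mul_inv]
  refine h5.congr_of_eventuallyEq ?_
  filter_upwards [h3, h4] with w hw hw2
  rw [← H.descend_weierstrassP hw2, hw]

variable {t : Fin D.N → ℂ} {c : ℂ} (H : D.IsProductSolution Ξ κ)
  (hδ : ∀ i, 2 * D.δ i ∉ D.L.lattice) (hb : Function.Injective D.b)
  (ht : ∀ a, ∀ᶠ x in 𝓝[≠] a, lamLogDeriv Ξ κ x = D.betheLog t c x)

include ht in
lemma hasSimplePole_of_betheLog (a : ℂ) :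
    HasSimplePole (lamLogDeriv Ξ κ) a (D.count t a - (D.weight a : ℂ) / 2) :=
  (D.hasSimplePole_betheLog t c a).congr (ht a)

include H hδ hb ht

lemma count_eq (a : ℂ) : D.count t a = 0 ∨ D.count t a = D.weight a + 1 := by
  obtain ⟨n, hn, h⟩ := H.exists_residue hδ hb a
  have := h.unique (hasSimplePole_of_betheLog ht a)
  have : n = D.count t a := by exact_mod_cast sub_left_injective this
  rwa [← this]

lemma count_neg_eq_zero {a : ℂ} (ha : D.count t a ≠ 0) : D.count t (-a) = 0 := by
  refine (H.count_eq hδ hb ht (-a)).resolve_right fun h2 => ?_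
  have h1 := (H.count_eq hδ hb ht a).resolve_left ha
  have e1 := hasSimplePole_of_betheLog ht a
  have e2 := hasSimplePole_of_betheLog ht (-a)
  rw [h1] at e1
  rw [h2, weight_neg hδ hb] at e2
  refine H.not_upper_of_upper (a := a) (m := D.weight a) ?_ ?_
  · convert e1 using 1
    push_cast; ring
  · convert e2 using 1
    push_cast; ring

lemma add_notMem_lattice (j j' : Fin D.N) : t j + t j' ∉ D.L.lattice := by
  intro h
  have h1 := count_pos t (a := t j) (j := j) (by simp)
  have h2 := count_pos t (a := -t j) (j := j') (by simpa [sub_eq_add_neg, add_comm] using neg_mem h)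
  exact h2.ne' (H.count_neg_eq_zero hδ hb ht h1.ne')

/-- At a zero of `Λ` the function `Ξ`, with its value there taken to be the limit `0`, has a simple
zero, and its derivative comes from the difference of the exponents. -/
lemma hasDerivAt_of_count_ne_zero {a : ℂ} (ha : D.count t a ≠ 0) :
    HasDerivAt Ξ (2 * κ / ((D.weight a : ℂ) + 1)) a := by
  have h1 := (H.count_eq hδ hb ht a).resolve_left ha
  have h2 := H.count_neg_eq_zero hδ hb ht ha
  have e1 := hasSimplePole_of_betheLog ht a
  have e2 := hasSimplePole_of_betheLog ht (-a)
  rw [h1] at e1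
  rw [h2, weight_neg hδ hb] at e2
  obtain ⟨n, hn, g, hg, -, hΞ⟩ := H.exists_eq_zpow_mul e1 e2
  have hn : n = 1 := by
    have : (n : ℂ) = (1 : ℤ) := by rw [hn]; push_cast; ring
    exact_mod_cast this
  subst hn
  simp only [zpow_one] at hΞ
  have hga : g a * ((D.weight a : ℂ) + 1) = 2 * κ := by
    have l1 := (e1.sub (H.hasSimplePole_neg e2)).tendsto_sub_mul
    have l2 := (hg.continuousAt.tendsto.mono_left (nhdsWithin_le_nhds (s := {a}ᶜ))).mul l1
    have l3 := tendsto_nhds_unique (l2.congr' (by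
      filter_upwards [hΞ, H.eventually_mul_sub a] with x h3 h4
      rw [← h4, h3]; ring)) (tendsto_const_nhds (x := 2 * κ))
    rw [← l3]
    push_cast
    ring
  have hd : HasDerivAt (fun x => (x - a) * g x) (2 * κ / ((D.weight a : ℂ) + 1)) a := by
    refine (((hasDerivAt_id a).sub_const a).fun_mul
      hg.differentiableAt.hasDerivAt).congr_deriv ?_
    have : (D.weight a : ℂ) + 1 ≠ 0 := Nat.cast_add_one_ne_zero _
    rw [← hga]
    field_simp
    simp
  have hΞa : Ξ a = (a - a) * g a := by
    by_cases has : a ∈ D.sing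
    · rw [H.eq_zero a has, sub_self, zero_mul]
    · exact (H.analyticAt a has).continuousAt.eq_of_eventually_nhdsNE hd.continuousAt hΞ
  refine hd.congr_of_eventuallyEq ?_
  rw [eventually_nhdsWithin_iff] at hΞ
  filter_upwards [hΞ] with x hx
  by_cases hxa : x = a
  · rw [hxa, hΞa]
  · exact hx hxa

/-- The order of `Ξ` at the origin is `-2 l₀`: the smaller exponent occurs there, because the larger
one cannot occur at a point congruent to its opposite. -/
lemma exists_analyticAt_pow_mul_eq : ∃ g : ℂ → ℂ, AnalyticAt ℂ g 0 ∧ g 0 ≠ 0 ∧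
    ∀ᶠ x in 𝓝[≠] 0, x ^ (2 * D.l 0) * Ξ x = g x := by
  have h0 : D.count t 0 = 0 := by
    by_contra h
    exact h (by simpa using H.count_neg_eq_zero hδ hb ht h)
  have e1 := hasSimplePole_of_betheLog ht 0
  rw [h0] at e1
  obtain ⟨n, hn, g, hg, hg0, hΞ⟩ := H.exists_eq_zpow_mul e1 (by simpa using e1)
  rw [weight_eq_l hδ hb (i := 0) (by simp [PeriodPair.halfPeriod])] at hn
  have hn : n = -(2 * D.l 0 : ℕ) := by
    have : (n : ℂ) = (-(2 * D.l 0 : ℕ) : ℤ) := by rw [hn]; push_cast; ring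
    exact_mod_cast this
  refine ⟨g, hg, hg0, ?_⟩
  filter_upwards [hΞ, self_mem_nhdsWithin] with x hx hx0
  rw [hx, sub_zero, hn, zpow_neg, zpow_natCast, mul_inv_cancel_left₀ (pow_ne_zero _ hx0)]

/-- The even part of the logarithmic derivative of `Λ` is `κ / Ξ`; its value at `0` is the even part
of the Bethe-Ansatz logarithmic derivative. -/
lemma tendsto_div : Tendsto (fun x => κ / Ξ x) (𝓝[≠] 0)
    (𝓝 (c - ∑ j, D.L.weierstrassZeta (t j))) := by
  have htj : ∀ j, -t j ∉ D.L.lattice := fun j h =>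
    H.add_notMem_lattice hδ hb ht j j (by
      rw [D.L.neg_mem_lattice_iff] at h; exact add_mem h h)
  have hz : ∀ j, ContinuousAt (fun x => D.L.weierstrassZeta (x - t j)) 0 := fun j =>
    ContinuousAt.comp (f := fun x => x - t j)
      (D.L.analyticAt_weierstrassZeta (by simpa using htj j)).continuousAt (by fun_prop)
  have hz' : ∀ j, ContinuousAt (fun x => D.L.weierstrassZeta (-x - t j)) 0 := fun j =>
    ContinuousAt.comp (f := fun x => -x - t j)
      (D.L.analyticAt_weierstrassZeta (by simpa using htj j)).continuousAt (by fun_prop)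
  have hc : Tendsto (fun x => c + (∑ j, D.L.weierstrassZeta (x - t j) +
      ∑ j, D.L.weierstrassZeta (-x - t j)) / 2) (𝓝 0)
      (𝓝 (c + (∑ j, D.L.weierstrassZeta (0 - t j) + ∑ j, D.L.weierstrassZeta (-0 - t j)) / 2)) :=
    tendsto_const_nhds.add (((tendsto_finsetSum _ fun j _ => (hz j).tendsto).add
      (tendsto_finsetSum _ fun j _ => (hz' j).tendsto)).div_const 2)
  have e : c + (∑ j, D.L.weierstrassZeta (0 - t j) + ∑ j, D.L.weierstrassZeta (-0 - t j)) / 2 =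
      c - ∑ j, D.L.weierstrassZeta (t j) := by
    simp only [neg_zero, zero_sub, D.L.weierstrassZeta_neg, Finset.sum_neg_distrib]
    ring
  rw [e] at hc
  refine (hc.mono_left nhdsWithin_le_nhds).congr' ?_
  have hneg := (tendsto_neg_nhdsNE 0).eventually (by simpa using ht 0)
  filter_upwards [ht 0, hneg, H.eventually_ne_zero 0, D.eventually_notMem_sing 0]
    with x h1 h2 h3 h4
  rw [H.lamLogDeriv_neg] at h2
  have h5 : κ / Ξ x = (lamLogDeriv Ξ κ x - lamLogDeriv Ξ (-κ) x) / 2 := by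
    simp only [lamLogDeriv]
    field_simp
    ring
  rw [h5, h1]
  simp only [betheLog, singLog_neg h4] at h2 ⊢
  linear_combination -h2 / 2

end IsProductSolution

end EllipticData

theorem mainTheorem6 (D : EllipticData)
    (hr : ∀ i, 0 < D.r i)
    (hδ : ∀ i, 2 * D.δ i ∉ D.L.lattice)
    (hb : Function.Injective D.b)
    (happ : ∀ i, IsApparentSingularity D.fuchsP D.fuchsQ (D.b i))
    (hdim : Module.finrank ℂ D.evenPeriodicSolutions = 1)
    (Ξ : ℂ → ℂ) (hΞ : Ξ ∈ D.evenPeriodicSolutions) (hΞ0 : Ξ ≠ 0)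
    (x₀ : ℂ) (hx₀ : x₀ ∉ D.sing) (hQ : D.Q Ξ x₀ ≠ 0)
    (κ : ℂ) (hκ : κ ^ 2 = -D.Q Ξ x₀) :
    (∃ (t : Fin D.N → ℂ) (c : ℂ), ∀ (U : Set ℂ) (Λ Ψ : ℂ → ℂ), D.IsRegularDomain Ξ U →
      EllipticData.IsLambdaBranch Ξ κ U Λ → D.IsPsiBranch U Ψ →
        ∃ C₀ : ℂ, D.IsBetheForm U Λ Ψ t c C₀) ∧
    (∀ (U : Set ℂ) (Λ Ψ : ℂ → ℂ), D.IsRegularDomain Ξ U →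
      EllipticData.IsLambdaBranch Ξ κ U Λ → D.IsPsiBranch U Ψ →
      ∀ (t : Fin D.N → ℂ) (c C₀ : ℂ), D.IsBetheForm U Λ Ψ t c C₀ →
        (∀ j j', t j + t j' ∉ D.L.lattice) ∧
        (∀ j, (∀ i, t j - D.δ i ∉ D.L.lattice ∧ t j + D.δ i ∉ D.L.lattice) →
          ∀ j', j' ≠ j → t j - t j' ∉ D.L.lattice) ∧
        (∀ j i, (t j - D.δ i ∈ D.L.lattice ∨ t j + D.δ i ∈ D.L.lattice) →
          {j' | t j - t j' ∈ D.L.lattice}.ncard = D.r i + 1) ∧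
        (D.l 0 ≠ 0 → c = ∑ j, D.L.weierstrassZeta (t j)) ∧
        (D.l 0 = 0 → ∃ Ξ₀ : ℂ, Ξ₀ ≠ 0 ∧ Tendsto Ξ (𝓝[≠] 0) (𝓝 Ξ₀) ∧
          c = ∑ j, D.L.weierstrassZeta (t j) + κ / Ξ₀) ∧
        (∃ X : ℂ → ℂ, (∀ x ∉ D.sing, Ξ x = X (D.L.weierstrassP x)) ∧
          (∀ j, (∀ i, t j - D.δ i ∉ D.L.lattice ∧ t j + D.δ i ∉ D.L.lattice) →
            HasDerivAt X (2 * κ / D.L.derivWeierstrassP (t j)) (D.L.weierstrassP (t j))) ∧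
          (∀ j i, (t j - D.δ i ∈ D.L.lattice ∨ t j + D.δ i ∈ D.L.lattice) →
            HasDerivAt X (2 * κ / (((D.r i : ℂ) + 1) * D.L.derivWeierstrassP (t j)))
              (D.L.weierstrassP (t j))))) := by
  have H := EllipticData.isProductSolution_of_mem hδ hΞ hΞ0 hx₀ hQ hκ
  obtain ⟨t, c, ht⟩ := H.exists_betheLog hδ hb
  refine ⟨⟨t, c, fun U Λ Ψ hU hΛ hΨ => H.exists_isBetheForm hδ ht hU hΛ hΨ⟩, ?_⟩
  clear ht t c
  intro U Λ Ψ hU hΛ hΨ t c C₀ hB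
  have ht := H.eventually_eq_betheLog hδ hU hΛ hΨ hB
  have hadd := H.add_notMem_lattice hδ hb ht
  have h2t : ∀ j, 2 * t j ∉ D.L.lattice := fun j => by rw [two_mul]; exact hadd j j
  have hpos : ∀ j, D.count t (t j) ≠ 0 := fun j =>
    (EllipticData.count_pos t (j := j) (by simp)).ne'
  have hcount : ∀ j, D.count t (t j) = D.weight (t j) + 1 := fun j =>
    (H.count_eq hδ hb ht (t j)).resolve_left (hpos j)
  have hgen : ∀ j, (∀ i, t j - D.δ i ∉ D.L.lattice ∧ t j + D.δ i ∉ D.L.lattice) →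
      D.weight (t j) = 0 := fun j hj => EllipticData.weight_eq_zero (by
    rintro (h | ⟨i, h | h⟩)
    · exact h2t j h
    · exact (hj i).1 h
    · exact (hj i).2 h)
  have hdX := fun j => H.hasDerivAt_descend (h2t j)
    (H.hasDerivAt_of_count_ne_zero hδ hb ht (hpos j))
  obtain ⟨g, hg, hg0, hΞg⟩ := H.exists_analyticAt_pow_mul_eq hδ hb ht
  have hg' := hg.continuousAt.tendsto.mono_left (nhdsWithin_le_nhds (s := {0}ᶜ))
  have hlim := H.tendsto_div hδ hb ht
  refine ⟨hadd, fun j hj j' hne h => ?_, fun j i h => ?_, fun hl => ?_, fun hl => ?_,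
    D.descend Ξ, fun x hx => ?_, fun j hj => ?_, fun j i h => ?_⟩
  · have h1 := hcount j
    rw [hgen j hj, zero_add, EllipticData.count, Set.ncard_eq_one] at h1
    obtain ⟨k, hk⟩ := h1
    have e1 : j ∈ ({k} : Set (Fin D.N)) := hk ▸ (by simp)
    have e2 : j' ∈ ({k} : Set (Fin D.N)) := hk ▸ h
    exact hne (e2.trans e1.symm)
  · rw [← EllipticData.weight_eq_r hδ hb h]
    exact hcount j
  · have h1 : Tendsto (fun x : ℂ => κ * x ^ (2 * D.l 0) / g x) (𝓝[≠] 0)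
        (𝓝 (κ * 0 ^ (2 * D.l 0) / g 0)) := by
      refine Tendsto.div (Tendsto.mono_left ?_ nhdsWithin_le_nhds) hg' hg0
      exact (Continuous.tendsto (by fun_prop) 0)
    have h2 := tendsto_nhds_unique hlim (h1.congr' (by
      filter_upwards [hΞg, self_mem_nhdsWithin, H.eventually_ne_zero 0] with x hx hx0 hΞx
      have hx0 : x ≠ 0 := hx0
      rw [← hx]
      field_simp))
    rw [zero_pow (by omega), mul_zero, zero_div] at h2
    linear_combination h2
  · have h1 : Tendsto Ξ (𝓝[≠] 0) (𝓝 (g 0)) := hg'.congr' (by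
      filter_upwards [hΞg] with x hx
      rw [← hx, hl]; simp)
    refine ⟨g 0, hg0, h1, ?_⟩
    have h2 := tendsto_nhds_unique hlim ((tendsto_const_nhds (x := κ)).div h1 hg0)
    linear_combination h2
  · exact (H.descend_weierstrassP (EllipticData.notMem_lattice hx)).symm
  · have := hdX j
    rwa [hgen j hj, Nat.cast_zero, zero_add, div_one] at this
  · have := hdX j
    rwa [EllipticData.weight_eq_r hδ hb h, div_div] at this
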